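/- Setting. Cells are the points of $\mathbb Z^2$; two cells are neighbours if they are horizontally or vertically adjacent. A shape is a finite set of cells (its nodes); it is connected if it is nonempty and its neighbour graph is connected. A shape $S$ is orthogonal convex if every cell lying between two nodes of $S$ in the same row or the same column is in $S$. A node at $u$ of a shape $A$ can rotate (by $90^\circ$) around a neighbouring node $v\in A$ to the cell $w$, where $w$ is a neighbour of $v$ that differs from $u$ in both coordinates, iff $w$ and the cell $u+w-v$ are both empty. A cell is marked for $S$ if every infinite simple path of neighbouring cells from it meets $S$ (i.e. it is in $S$ or in a hole of $S$). The perimeter of $S$ consists of the unit segments separating a marked from an unmarked cell, and the cell perimeter of $S$ is the set of unmarked cells contributing such a segment. A 6-robot is a set of six nodes forming a $2\times 3$ block, in either orientation; it lies along the perimeter of $S$ if it is disjoint from $S$ and at least one unit segment of one of its long sides belongs to the perimeter of $S$. Theorem. Let $S$ be a connected orthogonal convex shape. Then there is a 6-robot that lies along the perimeter of $S$, and every such 6-robot can traverse the entire perimeter of $S$: there is a finite sequence of single rotations of robot nodes (around neighbouring nodes of the robot or of $S$; the nodes of $S$ never move), starting from the given 6-robot, such that 1. the union of $S$ and the six robot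 nodes is a connected shape before and after every rotation; 2. for every cell $c$ of the cell perimeter of $S$ there is a time at which the robot nodes form a $2\times3$ block containing $c$; 3. the robot goes around $S$: for every $s=(a,b)\in S$, each of the six nodes makes at least one net clockwise turn around $s$, i.e. crosses the half-line $\{x=a+\tfrac12,\ y>b\}$ from left to right at least once more often than from right to left (a rotation being represented by the straight segment from the old to the new cell); 4. at the end the six nodes occupy the same six cells as at the start. -/

import Mathlib

namespace RotRobot

/-- A cell of the two-dimensional square grid. A shape is a finite set of (occupied) cells. -/
abbrev Cell := ℤ × ℤ

/-- The neighbouring relation: horizontally or vertically adjacent cells. -/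
def grid : SimpleGraph Cell where
  Adj u v := (u.1 = v.1 ∧ |u.2 - v.2| = 1) ∨ (u.2 = v.2 ∧ |u.1 - v.1| = 1)
  symm := ⟨by
    rintro u v (⟨h, h'⟩ | ⟨h, h'⟩)
    · exact Or.inl ⟨h.symm, by rw [abs_sub_comm]; exact h'⟩
    · exact Or.inr ⟨h.symm, by rw [abs_sub_comm]; exact h'⟩⟩
  loopless := ⟨by
    rintro u (⟨-, h⟩ | ⟨-, h⟩) <;> simp at h⟩

/-- A shape is connected if the neighbouring relation on its cells is a connected graph
(in particular the shape is nonempty). -/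
def ConnectedShape (A : Finset Cell) : Prop :=
  (grid.induce (A : Set Cell)).Connected

/-- Orthogonal convexity: no empty cell lies between two nodes of the same row or column. -/
def OrthConvex (S : Finset Cell) : Prop :=
  (∀ x y₁ y₂ : ℤ, (x, y₁) ∈ S → (x, y₂) ∈ S → ∀ y, y₁ < y → y < y₂ → (x, y) ∈ S) ∧
  (∀ y x₁ x₂ : ℤ, (x₁, y) ∈ S → (x₂, y) ∈ S → ∀ x, x₁ < x → x < x₂ → (x, y) ∈ S)

/-- A cell is marked if it is occupied or part of a hole, i.e. if every infinite simple path
in the grid that starts at the cell goes through an occupied cell. -/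
def Marked (A : Finset Cell) (c : Cell) : Prop :=
  ∀ γ : ℕ → Cell, γ 0 = c → Function.Injective γ →
    (∀ i, grid.Adj (γ i) (γ (i + 1))) → ∃ i, γ i ∈ A

/-- The unit segments of the perimeter of `A`: the segment shared by two neighbouring cells
`a`, `c` is encoded by the pair `(a, c)`, where `a` is the marked cell on the inner side and
`c` is the unmarked cell on the outer side. -/
def perimeter (A : Finset Cell) : Set (Cell × Cell) :=
  {e | Marked A e.1 ∧ ¬ Marked A e.2 ∧ grid.Adj e.1 e.2}

/-- The unmarked cells that contribute a segment to the perimeter. -/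
def cellPerimeter (A : Finset Cell) : Set Cell :=
  {c | ∃ a, (a, c) ∈ perimeter A}

/-- In the shape `A`, the node at `u` can rotate by 90 degrees around a neighbouring node `v`
of `A` into the cell `w`: the cell `w` and the cell `u + w - v`, which completes the
`2 × 2` square on `u`, `v`, `w`, are both empty. -/
def CanRotate (A : Finset Cell) (u w : Cell) : Prop :=
  u ∈ A ∧ ∃ v ∈ A, grid.Adj u v ∧ grid.Adj v w ∧ u.1 ≠ w.1 ∧ u.2 ≠ w.2 ∧
    w ∉ A ∧ u + w - v ∉ A

/-- The set of cells occupied by six (labelled) robot nodes. -/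
def nodes (p : Fin 6 → Cell) : Finset Cell := Finset.univ.image p

/-- The block of 3 columns and 2 rows with lower left cell `a`. -/
def horizontalBlock (a : Cell) : Finset Cell :=
  {(a.1, a.2), (a.1 + 1, a.2), (a.1 + 2, a.2),
    (a.1, a.2 + 1), (a.1 + 1, a.2 + 1), (a.1 + 2, a.2 + 1)}

/-- The block of 2 columns and 3 rows with lower left cell `a`. -/
def verticalBlock (a : Cell) : Finset Cell :=
  {(a.1, a.2), (a.1 + 1, a.2), (a.1, a.2 + 1),
    (a.1 + 1, a.2 + 1), (a.1, a.2 + 2), (a.1 + 1, a.2 + 2)}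

/-- The six nodes form a `2 × 3` block, in one of its two orientations. -/
def IsSixRobot (p : Fin 6 → Cell) : Prop :=
  ∃ a, nodes p = horizontalBlock a ∨ nodes p = verticalBlock a

/-- The six nodes form a `2 × 3` block outside `S` that lies along the perimeter of `S`: at
least one unit segment of a long side of the block belongs to the perimeter. -/
def LiesAlongPerimeter (S : Finset Cell) (p : Fin 6 → Cell) : Prop :=
  Disjoint S (nodes p) ∧
  ((∃ a, nodes p = horizontalBlock a ∧
      ∃ s c, (s, c) ∈ perimeter S ∧ c ∈ nodes p ∧ s.1 = c.1) ∨
   (∃ a, nodes p = verticalBlock a ∧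
      ∃ s c, (s, c) ∈ perimeter S ∧ c ∈ nodes p ∧ s.2 = c.2))

/-- `q 0, q 1, …, q T` are successive positions of the six robot nodes: each step is one rotation
of one robot node around a neighbouring node (of the robot or of `S`), the nodes of `S` do not
move, and the whole shape is connected at all times. -/
structure IsRobotRun (S : Finset Cell) (T : ℕ) (q : ℕ → Fin 6 → Cell) : Prop where
  step : ∀ t < T, ∃ i w, CanRotate (S ∪ nodes (q t)) (q t i) w ∧
    q (t + 1) = Function.update (q t) i w
  connected : ∀ t ≤ T, ConnectedShape (S ∪ nodes (q t))

/-- The signed number (`1` clockwise, `-1` counterclockwise, `0` otherwise) of crossings of the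
vertical line `x = s.1 + 1/2`, above the height of `s`, by a node that moves from `u` to `w`,
where `w = u` or `w` is diagonally adjacent to `u`. -/
def crossing (s u w : Cell) : ℤ :=
  if 2 * s.2 < u.2 + w.2 then
    if u.1 ≤ s.1 ∧ s.1 < w.1 then 1
    else if w.1 ≤ s.1 ∧ s.1 < u.1 then -1
    else 0
  else 0

/-- The net number of clockwise turns around the cell `s` that node `i` makes during a run,
counted by its crossings of a half-line that starts at `s`. -/
def turns (s : Cell) (T : ℕ) (q : ℕ → Fin 6 → Cell) (i : Fin 6) : ℤ :=
  ∑ t ∈ Finset.range T, crossing s (q t i) (q (t + 1) i)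

/-- A run of the robot that traverses the entire perimeter of `S` and returns: every cell of the
cell perimeter is at some time covered by the robot in its `2 × 3` formation, each robot node
goes all the way around every cell of `S`, and at the end the robot is back in its place. -/
structure IsTraversal (S : Finset Cell) (T : ℕ) (q : ℕ → Fin 6 → Cell) : Prop where
  run : IsRobotRun S T q
  covers : ∀ c ∈ cellPerimeter S, ∃ t ≤ T, IsSixRobot (q t) ∧ c ∈ nodes (q t)
  around : ∀ s ∈ S, ∀ i, 1 ≤ turns s T q i
  returns : nodes (q T) = nodes (q 0)

end RotRobot

namespace RotRobot

/-! ### Connected shapes -/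

/-! Seen from a diagonal direction, a connected orthogonal convex shape is a monotone staircase. In
the upper right quadrant, a touching block has a completely empty quadrant above and to the right of
its lower left cell (`Free`), so three local manoeuvres suffice: sliding along a side
(`reach_slide`), rounding a convex corner (`reach_corner`) and switching orientation in a concave
corner (`reach_turn`). Each is a fixed list of rotations, verified by evaluating `plan`. Repeating
them takes every such block down the staircase to one canonical end (`reach_end`); as rotations are
reversible, all touching blocks of the quadrant reach each other (`reach_of_isUpperRightBlock`).

The other quadrants follow by reflection. Every block along the perimeter belongs to some quadrant;
the geometric reason is `free_or_free`. A suitable block beyond an extreme row or column belongs to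
two adjacent quadrants, which links the four staircases into a circuit (`exists_circuit`).

Up to this point the nodes are unlabelled. Turns of individual nodes are recovered because crossings
telescope while the robot stays on one side of `S` (`crossing_eq`): going from the far left to the
far right above `S` gives every node exactly one turn, whatever the labels do, and returning below
gives none. Excursions that cover prescribed cells may lose turns, but only boundedly many, and
further circuits make up for them. -/

lemma grid_adj_iff {u v : Cell} : grid.Adj u v ↔
    (u.1 = v.1 ∧ (u.2 = v.2 + 1 ∨ v.2 = u.2 + 1)) ∨
      (u.2 = v.2 ∧ (u.1 = v.1 + 1 ∨ v.1 = u.1 + 1)) := by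
  have key : ∀ a b : ℤ, |a - b| = 1 ↔ (a = b + 1 ∨ b = a + 1) := fun a b => by
    rw [abs_eq zero_le_one]; omega
  change (_ ∧ _) ∨ (_ ∧ _) ↔ _
  rw [key, key]

/-- Connectedness in terms of cuts: every proper cut of the shape is crossed by an edge. -/
lemma connectedShape_iff {A : Finset Cell} : ConnectedShape A ↔
    A.Nonempty ∧ ∀ P : Cell → Prop, ∀ a ∈ A, ∀ b ∈ A, P a → ¬ P b →
      ∃ u ∈ A, ∃ v ∈ A, grid.Adj u v ∧ P u ∧ ¬ P v := by
  constructor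
  · intro h
    refine ⟨?_, ?_⟩
    · obtain ⟨⟨x, hx⟩⟩ := h.nonempty
      exact ⟨x, hx⟩
    · intro P a ha b hb hPa hPb
      obtain ⟨w⟩ := h.preconnected ⟨a, ha⟩ ⟨b, hb⟩
      obtain ⟨d, -, h1, h2⟩ := w.exists_boundary_dart {x | P x.1} hPa hPb
      exact ⟨d.fst.1, d.fst.2, d.snd.1, d.snd.2, d.adj, h1, h2⟩
  · rintro ⟨⟨x, hx⟩, h⟩
    have : Nonempty ((A : Set Cell) : Type) := ⟨⟨x, hx⟩⟩
    refine ⟨?_⟩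
    rintro ⟨a, ha⟩ ⟨b, hb⟩
    by_contra hab
    obtain ⟨u, hu, v, hv, huv, ⟨hu', hau⟩, hav⟩ :=
      h (fun y => ∃ hy : y ∈ (A : Set Cell), (grid.induce (A : Set Cell)).Reachable ⟨a, ha⟩ ⟨y, hy⟩)
        a ha b hb ⟨ha, SimpleGraph.Reachable.refl _⟩ (fun ⟨_, h⟩ => hab h)
    refine hav ⟨hv, hau.trans (SimpleGraph.Adj.reachable ?_)⟩
    exact huv

lemma ConnectedShape.union_of_forall_adj {A B : Finset Cell} (hA : ConnectedShape A)
    (hB : ∀ b ∈ B, ∃ a ∈ A, grid.Adj a b) : ConnectedShape (A ∪ B) := by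
  rw [connectedShape_iff] at hA ⊢
  obtain ⟨hne, hA⟩ := hA
  refine ⟨hne.mono Finset.subset_union_left, ?_⟩
  intro P a ha b hb hPa hPb
  by_cases hall : ∃ x ∈ A, ∃ y ∈ A, P x ∧ ¬ P y
  · obtain ⟨x, hx, y, hy, hPx, hPy⟩ := hall
    obtain ⟨u, hu, v, hv, h⟩ := hA P x hx y hy hPx hPy
    exact ⟨u, Finset.mem_union_left _ hu, v, Finset.mem_union_left _ hv, h⟩
  · push Not at hall
    have near : ∀ z ∈ A ∪ B, ∃ y ∈ A, y = z ∨ grid.Adj y z := by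
      intro z hz
      rcases Finset.mem_union.1 hz with hz | hz
      · exact ⟨z, hz, Or.inl rfl⟩
      · obtain ⟨y, hy, h⟩ := hB z hz
        exact ⟨y, hy, Or.inr h⟩
    obtain ⟨x, hx, hxa⟩ := near a ha
    obtain ⟨y, hy, hyb⟩ := near b hb
    by_cases hPx : P x
    · have hPy : P y := hall x hx y hy hPx
      rcases hyb with rfl | hyb
      · exact absurd hPy hPb
      · exact ⟨y, Finset.mem_union_left _ hy, b, hb, hyb, hPy, hPb⟩
    · rcases hxa with rfl | hxa
      · exact absurd hPa hPx
      · exact ⟨a, ha, x, Finset.mem_union_left _ hx, hxa.symm, hPa, hPx⟩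

/-! ### Symmetries of the grid -/

/-- An involutive symmetry of the grid that preserves the shape of rotations. -/
structure GridSymm (g : Cell → Cell) : Prop where
  invol : ∀ x, g (g x) = x
  adj : ∀ u v, grid.Adj u v → grid.Adj (g u) (g v)
  square : ∀ u v w, g u + g w - g v = g (u + w - v)
  diag : ∀ u w : Cell, u.1 ≠ w.1 → u.2 ≠ w.2 → (g u).1 ≠ (g w).1 ∧ (g u).2 ≠ (g w).2

namespace GridSymm

variable {g : Cell → Cell}

lemma injective (hg : GridSymm g) : Function.Injective g :=
  Function.LeftInverse.injective hg.invol

lemma mem_image (hg : GridSymm g) {A : Finset Cell} {x : Cell} : x ∈ A.image g ↔ g x ∈ A := by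
  constructor
  · intro h
    obtain ⟨y, hy, rfl⟩ := Finset.mem_image.1 h
    rwa [hg.invol]
  · intro h
    exact Finset.mem_image.2 ⟨g x, h, hg.invol x⟩

lemma image_image (hg : GridSymm g) (A : Finset Cell) : (A.image g).image g = A := by
  ext x
  rw [hg.mem_image, hg.mem_image, hg.invol]

lemma connectedShape (hg : GridSymm g) {A : Finset Cell} (hA : ConnectedShape A) :
    ConnectedShape (A.image g) := by
  rw [connectedShape_iff] at hA ⊢
  refine ⟨hA.1.image g, ?_⟩
  intro P a ha b hb hPa hPb
  obtain ⟨u, hu, v, hv, huv, hPu, hPv⟩ := hA.2 (fun x => P (g x)) (g a) (hg.mem_image.1 ha)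
    (g b) (hg.mem_image.1 hb) (by rwa [hg.invol]) (by rwa [hg.invol])
  exact ⟨g u, Finset.mem_image_of_mem g hu, g v, Finset.mem_image_of_mem g hv,
    hg.adj _ _ huv, hPu, hPv⟩

end GridSymm

/-! ### Moves of an unlabelled robot -/

/-- A rotation of one cell of `A` next to the fixed shape `S`, within the region `R`. -/
def Move (S : Finset Cell) (R : Set Cell) (A A' : Finset Cell) : Prop :=
  ∃ u v w, u ∈ A ∧ u ∉ S ∧ v ∈ S ∪ A ∧ grid.Adj u v ∧ grid.Adj v w ∧ u.1 ≠ w.1 ∧ u.2 ≠ w.2 ∧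
    w ∉ S ∪ A ∧ u + w - v ∉ S ∪ A ∧ u ∈ R ∧ w ∈ R ∧ A' = insert w (A.erase u) ∧
    ConnectedShape (S ∪ A) ∧ ConnectedShape (S ∪ A')

/-- Reachability by moves within the region `R`. -/
def Reach (S : Finset Cell) (R : Set Cell) : Finset Cell → Finset Cell → Prop :=
  Relation.ReflTransGen (Move S R)

/-- The rotation is undone around the same pivot: the fourth cell `u + w - v` of the square is
symmetric in `u` and `w`. -/
lemma Move.symm {S : Finset Cell} {R : Set Cell} {A A' : Finset Cell} (h : Move S R A A') :
    Move S R A' A := by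
  obtain ⟨u, v, w, hu, huS, hv, huv, hvw, h1, h2, hw, hz, huR, hwR, rfl, hc, hc'⟩ := h
  simp only [Finset.mem_union, not_or] at hw hz hv
  have huw : u ≠ w := fun h => h1 (by rw [h])
  refine ⟨w, v, u, Finset.mem_insert_self _ _, hw.1, ?_, hvw.symm, huv.symm, h1.symm, h2.symm,
    ?_, ?_, hwR, huR, ?_, hc', hc⟩
  · rcases hv with hv | hv
    · exact Finset.mem_union_left _ hv
    · exact Finset.mem_union_right _
        (Finset.mem_insert_of_mem (Finset.mem_erase.2 ⟨huv.ne', hv⟩))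
  · simp [huS, huw]
  · have e : w + u - v = u + w - v := by rw [add_comm]
    rw [e]
    have hzw : u + w - v ≠ w := by
      intro h
      apply huv.ne
      have : u + w - v - w = 0 := by rw [h, sub_self]
      have h' : u - v = u + w - v - w := by abel
      exact sub_eq_zero.1 (h'.trans this)
    simp [hz.1, hz.2, hzw]
  · rw [Finset.erase_insert (by simp [hw.2]), Finset.insert_erase hu]

lemma Move.mono {S : Finset Cell} {R R' : Set Cell} {A A' : Finset Cell} (h : Move S R A A')
    (hR : R ⊆ R') : Move S R' A A' := by
  obtain ⟨u, v, w, hu, huS, hv, huv, hvw, h1, h2, hw, hz, huR, hwR, h⟩ := h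
  exact ⟨u, v, w, hu, huS, hv, huv, hvw, h1, h2, hw, hz, hR huR, hR hwR, h⟩

lemma Move.image {S : Finset Cell} {R : Set Cell} {A A' : Finset Cell} {g : Cell → Cell}
    (hg : GridSymm g) (h : Move S R A A') :
    Move (S.image g) (g ⁻¹' R) (A.image g) (A'.image g) := by
  obtain ⟨u, v, w, hu, huS, hv, huv, hvw, h1, h2, hw, hz, huR, hwR, rfl, hc, hc'⟩ := h
  refine ⟨g u, g v, g w, Finset.mem_image_of_mem g hu, ?_, ?_, hg.adj _ _ huv, hg.adj _ _ hvw,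
    (hg.diag u w h1 h2).1, (hg.diag u w h1 h2).2, ?_, ?_, ?_, ?_, ?_, ?_, ?_⟩
  · rwa [hg.mem_image, hg.invol]
  · rw [← Finset.image_union]; exact Finset.mem_image_of_mem g hv
  · rwa [← Finset.image_union, hg.mem_image, hg.invol]
  · rwa [← Finset.image_union, hg.square, hg.mem_image, hg.invol]
  · simpa [hg.invol] using huR
  · simpa [hg.invol] using hwR
  · rw [Finset.image_insert, Finset.image_erase hg.injective]
  · rw [← Finset.image_union]; exact hg.connectedShape hc
  · rw [← Finset.image_union]; exact hg.connectedShape hc'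

lemma Move.card_eq {S : Finset Cell} {R : Set Cell} {A A' : Finset Cell} (h : Move S R A A') :
    A'.card = A.card := by
  obtain ⟨u, v, w, hu, -, -, -, -, -, -, hw, -, -, -, rfl, -⟩ := h
  simp only [Finset.mem_union, not_or] at hw
  rw [Finset.card_insert_of_notMem (by simp [hw.2]), Finset.card_erase_of_mem hu]
  have := Finset.card_pos.2 ⟨u, hu⟩
  omega

lemma Reach.trans {S : Finset Cell} {R : Set Cell} {A B C : Finset Cell} (h : Reach S R A B)
    (h' : Reach S R B C) : Reach S R A C :=
  Relation.ReflTransGen.trans h h'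

lemma Reach.symm {S : Finset Cell} {R : Set Cell} {A B : Finset Cell} (h : Reach S R A B) :
    Reach S R B A := by
  induction h with
  | refl => exact Relation.ReflTransGen.refl
  | tail _ h ih => exact Relation.ReflTransGen.head h.symm ih

lemma Reach.mono {S : Finset Cell} {R R' : Set Cell} {A B : Finset Cell} (h : Reach S R A B)
    (hR : R ⊆ R') : Reach S R' A B := by
  induction h with
  | refl => exact Relation.ReflTransGen.refl
  | tail _ h ih => exact Relation.ReflTransGen.tail ih (h.mono hR)

lemma Reach.image {S : Finset Cell} {R : Set Cell} {A B : Finset Cell} {g : Cell → Cell}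
    (hg : GridSymm g) (h : Reach S R A B) :
    Reach (S.image g) (g ⁻¹' R) (A.image g) (B.image g) := by
  induction h with
  | refl => exact Relation.ReflTransGen.refl
  | tail _ h ih => exact Relation.ReflTransGen.tail ih (h.image hg)

end RotRobot

namespace RotRobot

/-! ### Checking explicit sequences of moves -/

/-- No cell of `S` lies weakly above and to the right of `c`. -/
def Free (S : Finset Cell) (c : Cell) : Prop :=
  ∀ s ∈ S, ¬ (c.1 ≤ s.1 ∧ c.2 ≤ s.2)

lemma Free.mono {S : Finset Cell} {c d : Cell} (h : Free S c) (h1 : c.1 ≤ d.1) (h2 : c.2 ≤ d.2) :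
    Free S d :=
  fun s hs hd => h s hs ⟨h1.trans hd.1, h2.trans hd.2⟩

lemma Free.notMem {S : Finset Cell} {c : Cell} (h : Free S c) : c ∉ S :=
  fun hc => h c hc ⟨le_rfl, le_rfl⟩

/-- The neighbouring relation as a computable test. -/
def nb (u v : Cell) : Bool :=
  (u.1 == v.1 && (u.2 == v.2 + 1 || v.2 == u.2 + 1)) ||
    (u.2 == v.2 && (u.1 == v.1 + 1 || v.1 == u.1 + 1))

/-- `c` lies in one of the quadrants with lower left cell in `F`. -/
def inQuadrants (F : List Cell) (c : Cell) : Bool :=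
  F.any fun f => decide (f.1 ≤ c.1) && decide (f.2 ≤ c.2)

/-- Add to `X` all cells of `A` that have a neighbour in `X`. -/
def spread (A X : List Cell) : List Cell :=
  X ++ A.filter fun a => X.any fun x => nb x a

/-- Every cell of `A` is connected within `A` to the cells `K`. -/
def attached (K A : List Cell) : Bool :=
  A.all fun a => ((spread A)^[6] K).contains a

/-- One step of an explicit sequence of moves `(u, v, w)`: `u` rotates around `v` to `w`. -/
def stepOK (F K A : List Cell) (m : Cell × Cell × Cell) : Bool :=
  A.contains m.1 && (A.contains m.2.1 || K.contains m.2.1) && nb m.1 m.2.1 && nb m.2.1 m.2.2 &&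
  m.1.1 != m.2.2.1 && m.1.2 != m.2.2.2 && !A.contains m.2.2 &&
  !A.contains (m.1 + m.2.2 - m.2.1) && inQuadrants F m.1 && inQuadrants F m.2.2 &&
  inQuadrants F (m.1 + m.2.2 - m.2.1) && attached K A

/-- The sequence of moves leads from `A` to `B`, given that `S` contains the cells `K` and does
not meet the quadrants `F`. -/
def plan (F K : List Cell) : List (Cell × Cell × Cell) → List Cell → List Cell → Bool
  | [], A, B => attached K A && A.all B.contains && B.all A.contains
  | m :: l, A, B => stepOK F K A m && plan F K l (m.2.2 :: A.filter (· != m.1)) B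

/-- The translate by `c` of a list of cells, as a shape. -/
def place (c : Cell) (A : List Cell) : Finset Cell :=
  (A.map (c + ·)).toFinset

lemma add_mem_place {c x : Cell} {A : List Cell} : c + x ∈ place c A ↔ x ∈ A := by
  simp [place]

lemma mem_place {c x : Cell} {A : List Cell} : x ∈ place c A ↔ x - c ∈ A := by
  rw [← add_mem_place (c := c)]; simp

lemma grid_adj_of_nb {u v : Cell} (c : Cell) (h : nb u v = true) : grid.Adj (c + u) (c + v) := by
  simp only [nb, Bool.or_eq_true, Bool.and_eq_true, beq_iff_eq] at h
  rw [grid_adj_iff]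
  simp only [Prod.fst_add, Prod.snd_add]
  omega

lemma free_of_inQuadrants {S : Finset Cell} {c x : Cell} {F : List Cell}
    (hF : ∀ f ∈ F, Free S (c + f)) (h : inQuadrants F x = true) : Free S (c + x) := by
  simp only [inQuadrants, List.any_eq_true, Bool.and_eq_true, decide_eq_true_eq] at h
  obtain ⟨f, hf, h1, h2⟩ := h
  exact (hF f hf).mono (by simpa using h1) (by simpa using h2)

/-- Grow `S` in layers: each round of `spread` adds nodes adjacent to a part already known to be
connected. The anchors `K` need not be adjacent to one another, since `S` joins them. -/
lemma connectedShape_of_attached {S : Finset Cell} {c : Cell} {K A : List Cell}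
    (hS : ConnectedShape S) (hK : ∀ k ∈ K, c + k ∈ S) (h : attached K A = true) :
    ConnectedShape (S ∪ place c A) := by
  classical
  have key : ∀ n : ℕ, ∃ X : Finset Cell, S ⊆ X ∧ X ⊆ S ∪ place c A ∧ ConnectedShape X ∧
      ∀ x ∈ (spread A)^[n] K, c + x ∈ X := by
    intro n
    induction n with
    | zero => exact ⟨S, le_rfl, Finset.subset_union_left, hS, hK⟩
    | succ n ih =>
      obtain ⟨X, h1, h2, h3, h4⟩ := ih
      refine ⟨X ∪ (place c A).filter (fun a => ∃ x ∈ X, grid.Adj x a),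
        h1.trans Finset.subset_union_left, ?_, ?_, ?_⟩
      · exact Finset.union_subset h2
          ((Finset.filter_subset _ _).trans Finset.subset_union_right)
      · exact h3.union_of_forall_adj fun b hb => (Finset.mem_filter.1 hb).2
      · intro x hx
        rw [Function.iterate_succ_apply', spread, List.mem_append] at hx
        rcases hx with hx | hx
        · exact Finset.mem_union_left _ (h4 x hx)
        · rw [List.mem_filter, List.any_eq_true] at hx
          obtain ⟨hxA, y, hy, hyx⟩ := hx
          exact Finset.mem_union_right _ (Finset.mem_filter.2
            ⟨add_mem_place.2 hxA, c + y, h4 y hy, grid_adj_of_nb c hyx⟩)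
  -- The number of rounds is the one in `attached`; six suffice for six nodes, as a round that adds
  -- no node ends the growth.
  obtain ⟨X, h1, h2, h3, h4⟩ := key 6
  have : X = S ∪ place c A := by
    refine Finset.Subset.antisymm h2 (Finset.union_subset h1 ?_)
    intro x hx
    rw [mem_place] at hx
    have := h4 (x - c) (by simpa using List.all_eq_true.1 h _ hx)
    simpa using this
  rwa [← this]

/-- This reduces arbitrary shapes to a finite check: a manoeuvre only has to know some empty
quadrants `F` and a few occupied cells `K`, relative to `c`. -/
lemma reach_of_plan {S : Finset Cell} (hS : ConnectedShape S) (c : Cell) (F K : List Cell)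
    (hF : ∀ f ∈ F, Free S (c.1 + f.1, c.2 + f.2))
    (hK : ∀ k ∈ K, (c.1 + k.1, c.2 + k.2) ∈ S) (l : List (Cell × Cell × Cell))
    (A B : List Cell) (h : plan F K l A B = true) :
    Reach S {x | Free S x} (place c A) (place c B) := by
  have hconn : ∀ l A, plan F K l A B = true → ConnectedShape (S ∪ place c A) := by
    intro l A h
    cases l with
    | nil =>
      simp only [plan, Bool.and_eq_true] at h
      exact connectedShape_of_attached hS hK h.1.1
    | cons m l =>
      simp only [plan, stepOK, Bool.and_eq_true] at h
      exact connectedShape_of_attached hS hK h.1.2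
  induction l generalizing A with
  | nil =>
    simp only [plan, Bool.and_eq_true, List.all_eq_true, List.contains_iff_mem] at h
    have : place c A = place c B := by
      ext x
      rw [mem_place, mem_place]
      exact ⟨h.1.2 _, h.2 _⟩
    rw [this]
    exact Relation.ReflTransGen.refl
  | cons m l ih =>
    have hA := hconn _ _ h
    obtain ⟨u, v, w⟩ := m
    simp only [plan, Bool.and_eq_true] at h
    refine Relation.ReflTransGen.head ?_ (ih _ h.2)
    have hA' := hconn _ _ h.2
    have h := h.1
    simp only [stepOK, Bool.and_eq_true, Bool.or_eq_true, bne_iff_ne,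
      Bool.not_eq_true', List.contains_eq_mem, decide_eq_false_iff_not, decide_eq_true_eq] at h
    obtain ⟨⟨⟨⟨⟨⟨⟨⟨⟨⟨⟨hu, hv⟩, huv⟩, hvw⟩, h1⟩, h2⟩, hw⟩, hz⟩, hfu⟩, hfw⟩, hfz⟩, -⟩ := h
    have fu := free_of_inQuadrants hF hfu
    have fw := free_of_inQuadrants hF hfw
    have fz := free_of_inQuadrants hF hfz
    have ez : c + u + (c + w) - (c + v) = c + (u + w - v) := by abel
    refine ⟨c + u, c + v, c + w, add_mem_place.2 hu, fu.notMem, ?_, grid_adj_of_nb c huv,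
      grid_adj_of_nb c hvw, by simpa using h1, by simpa using h2, ?_, ?_, fu, fw, ?_, hA, hA'⟩
    · rcases hv with hv | hv
      · exact Finset.mem_union_right _ (add_mem_place.2 hv)
      · exact Finset.mem_union_left _ (hK v hv)
    · rw [Finset.mem_union, add_mem_place]
      exact not_or.2 ⟨fw.notMem, hw⟩
    · rw [ez, Finset.mem_union, add_mem_place]
      exact not_or.2 ⟨fz.notMem, hz⟩
    · ext x
      simp only [mem_place, Finset.mem_insert, Finset.mem_erase, List.mem_cons, List.mem_filter,
        bne_iff_ne, ne_eq, sub_eq_iff_eq_add']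
      tauto

/-! ### The elementary manoeuvres -/

lemma place_flat (x y a b : ℤ) : place (x, y)
    [(a, b), (a + 1, b), (a + 2, b), (a, b + 1), (a + 1, b + 1), (a + 2, b + 1)]
      = horizontalBlock (x + a, y + b) := by
  ext ⟨x, y⟩
  simp [mem_place, horizontalBlock, Prod.ext_iff, sub_eq_iff_eq_add', add_assoc]

lemma place_upright (x y a b : ℤ) : place (x, y)
    [(a, b), (a + 1, b), (a, b + 1), (a + 1, b + 1), (a, b + 2), (a + 1, b + 2)]
      = verticalBlock (x + a, y + b) := by
  ext ⟨x, y⟩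
  simp [mem_place, verticalBlock, Prod.ext_iff, sub_eq_iff_eq_add', add_assoc]

variable {S : Finset Cell} {x y : ℤ}

/-- The nodes at relative positions `(1, 0)` and `(2, 0)` never move, so a floor cell under either
of them holds the robot throughout and the same six rotations serve both cases. -/
lemma reach_slide (hS : ConnectedShape S) (hc : Free S (x, y))
    (h : (x + 1, y - 1) ∈ S ∨ (x + 2, y - 1) ∈ S) :
    Reach S {c | Free S c} (horizontalBlock (x, y)) (horizontalBlock (x + 1, y)) := by
  have e0 := place_flat x y 0 0
  have e1 := place_flat x y 1 0
  simp only [add_zero] at e0 e1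
  rw [← e0, ← e1]
  rcases h with h | h
  · refine reach_of_plan hS _ [(0, 0)] [(1, -1)] (by simpa using hc)
      (by simpa [← sub_eq_add_neg] using h)
      [((0, 1), (1, 1), (1, 2)), ((2, 1), (2, 0), (3, 0)), ((1, 2), (1, 1), (2, 1)),
        ((1, 1), (2, 1), (2, 2)), ((2, 2), (2, 1), (3, 1)), ((0, 0), (1, 0), (1, 1))] _ _ ?_
    decide +kernel
  · refine reach_of_plan hS _ [(0, 0)] [(2, -1)] (by simpa using hc)
      (by simpa [← sub_eq_add_neg] using h)
      [((0, 1), (1, 1), (1, 2)), ((2, 1), (2, 0), (3, 0)), ((1, 2), (1, 1), (2, 1)),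
        ((1, 1), (2, 1), (2, 2)), ((2, 2), (2, 1), (3, 1)), ((0, 0), (1, 0), (1, 1))] _ _ ?_
    decide +kernel

lemma reach_corner (hS : ConnectedShape S) (hc : Free S (x, y)) (hd : Free S (x + 1, y - 1))
    (h : (x, y - 1) ∈ S) :
    Reach S {c | Free S c} (horizontalBlock (x, y)) (verticalBlock (x + 1, y - 1)) := by
  have e0 := place_flat x y 0 0
  have e1 := place_upright x y 1 (-1)
  simp only [add_zero, ← sub_eq_add_neg] at e0 e1
  rw [← e0, ← e1]
  refine reach_of_plan hS _ [(0, 0), (1, -1)] [(0, -1)]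
    (by simpa [← sub_eq_add_neg] using And.intro hc hd) (by simpa [← sub_eq_add_neg] using h)
    [((1, 0), (2, 0), (2, -1)), ((0, 0), (0, -1), (1, -1)), ((0, 1), (1, 1), (1, 0))] _ _ ?_
  decide +kernel

/-- With three floor cells the rearrangement stays inside the empty quadrant and needs no support
from a wall. -/
lemma reach_turn_of_floor_three (hS : ConnectedShape S) (hc : Free S (x, y))
    (h0 : (x, y - 1) ∈ S) (h1 : (x + 1, y - 1) ∈ S) (h2 : (x + 2, y - 1) ∈ S) :
    Reach S {c | Free S c} (horizontalBlock (x, y)) (verticalBlock (x, y)) := by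
  have e0 := place_flat x y 0 0
  have e1 := place_upright x y 0 0
  simp only [add_zero] at e0 e1
  rw [← e0, ← e1]
  refine reach_of_plan hS _ [(0, 0)] [(0, -1), (1, -1), (2, -1)]
    (by simpa using hc) (by simpa [← sub_eq_add_neg] using ⟨h0, h1, h2⟩)
    [((2, 1), (2, 0), (3, 0)), ((1, 1), (0, 1), (0, 2)), ((1, 0), (2, 0), (2, 1)),
      ((0, 2), (0, 1), (1, 1)), ((2, 1), (1, 1), (1, 2)), ((3, 0), (2, 0), (2, 1)),
      ((2, 0), (2, 1), (3, 1)), ((3, 1), (2, 1), (2, 2)), ((2, 2), (1, 2), (1, 3)),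
      ((2, 1), (1, 1), (1, 0)), ((1, 3), (1, 2), (0, 2))] _ _ ?_
  decide +kernel

/-- The floor stops after two cells, and the empty cell at relative position `(2, -1)` serves as a
temporary parking place. -/
lemma reach_turn_of_floor_two (hS : ConnectedShape S) (hc : Free S (x, y))
    (hd : Free S (x + 2, y - 1)) (h0 : (x, y - 1) ∈ S) (h1 : (x + 1, y - 1) ∈ S)
    (hw : (x - 1, y) ∈ S) :
    Reach S {c | Free S c} (horizontalBlock (x, y)) (verticalBlock (x, y)) := by
  have e0 := place_flat x y 0 0
  have e1 := place_upright x y 0 0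
  simp only [add_zero] at e0 e1
  rw [← e0, ← e1]
  refine reach_of_plan hS _ [(0, 0), (2, -1)] [(0, -1), (1, -1), (-1, 0)]
    (by simpa [← sub_eq_add_neg] using And.intro hc hd)
    (by simpa [← sub_eq_add_neg] using ⟨h0, h1, hw⟩)
    [((2, 1), (2, 0), (3, 0)), ((1, 1), (0, 1), (0, 2)), ((3, 0), (2, 0), (2, -1)),
      ((1, 0), (2, 0), (2, 1)), ((2, 0), (2, 1), (1, 1)), ((2, -1), (1, -1), (1, 0)),
      ((2, 1), (1, 1), (1, 2))] _ _ ?_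
  decide +kernel

/-- Floor and wall both stop after one cell; nodes are parked at the relative positions `(1, -1)`
and `(-1, 1)` just beyond them. -/
lemma reach_turn_of_floor_one (hS : ConnectedShape S) (hc : Free S (x, y))
    (hd : Free S (x + 1, y - 1)) (hu : Free S (x - 1, y + 1)) (h0 : (x, y - 1) ∈ S)
    (hw : (x - 1, y) ∈ S) :
    Reach S {c | Free S c} (horizontalBlock (x, y)) (verticalBlock (x, y)) := by
  have e0 := place_flat x y 0 0
  have e1 := place_upright x y 0 0
  simp only [add_zero] at e0 e1
  rw [← e0, ← e1]
  refine reach_of_plan hS _ [(0, 0), (1, -1), (-1, 1)] [(0, -1), (-1, 0)]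
    (by simpa [← sub_eq_add_neg] using ⟨hc, hd, hu⟩)
    (by simpa [← sub_eq_add_neg] using ⟨h0, hw⟩)
    [((0, 1), (1, 1), (1, 2)), ((2, 0), (1, 0), (1, -1)), ((0, 0), (-1, 0), (-1, 1)),
      ((1, 0), (1, 1), (0, 1)), ((1, -1), (0, -1), (0, 0)), ((2, 1), (1, 1), (1, 0)),
      ((-1, 1), (0, 1), (0, 2))] _ _ ?_
  decide +kernel

end RotRobot

namespace RotRobot

/-! ### Reflections -/

lemma gridSymm_swap : GridSymm Prod.swap where
  invol := Prod.swap_swap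
  adj u v h := by
    rw [grid_adj_iff] at h ⊢
    simp only [Prod.fst_swap, Prod.snd_swap]
    omega
  square _ _ _ := rfl
  diag _ _ h1 h2 := ⟨h2, h1⟩

/-- Reflection in the coordinate axes according to the signs `a` and `b`. -/
def flip (a b : ℤˣ) (c : Cell) : Cell := (a * c.1, b * c.2)

lemma gridSymm_flip (a b : ℤˣ) : GridSymm (flip a b) := by
  constructor
  · rcases Int.units_eq_one_or a with rfl | rfl <;> rcases Int.units_eq_one_or b with rfl | rfl <;>
      simp [flip]
  · intro u v h
    rw [grid_adj_iff] at h ⊢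
    rcases Int.units_eq_one_or a with rfl | rfl <;> rcases Int.units_eq_one_or b with rfl | rfl <;>
      simp [flip] <;> omega
  · intro u v w
    ext <;> simp [flip] <;> ring
  · intro u w h1 h2
    simpa [flip] using ⟨h1, h2⟩

lemma flip_flip (a b c d : ℤˣ) (x : Cell) : flip a b (flip c d x) = flip (a * c) (b * d) x := by
  simp [flip, mul_assoc]

lemma image_flip_flip (a b c d : ℤˣ) (A : Finset Cell) :
    (A.image (flip c d)).image (flip a b) = A.image (flip (a * c) (b * d)) := by
  rw [Finset.image_image]
  exact Finset.image_congr fun x _ => flip_flip a b c d x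

lemma image_flip_swap (a b : ℤˣ) (A : Finset Cell) :
    (A.image Prod.swap).image (flip a b) = (A.image (flip b a)).image Prod.swap := by
  rw [Finset.image_image, Finset.image_image]
  rfl

lemma horizontalBlock_image_swap (x y : ℤ) :
    (horizontalBlock (x, y)).image Prod.swap = verticalBlock (y, x) := by
  ext ⟨u, v⟩
  simp only [gridSymm_swap.mem_image, horizontalBlock, verticalBlock, Finset.mem_insert,
    Finset.mem_singleton, Prod.ext_iff, Prod.swap]
  omega

lemma verticalBlock_image_swap (x y : ℤ) :
    (verticalBlock (x, y)).image Prod.swap = horizontalBlock (y, x) := by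
  rw [← horizontalBlock_image_swap, gridSymm_swap.image_image]

lemma horizontalBlock_image_flip_left (x y : ℤ) :
    (horizontalBlock (x, y)).image (flip (-1) 1) = horizontalBlock (-x - 2, y) := by
  ext ⟨u, v⟩
  simp [horizontalBlock, flip]
  omega

lemma horizontalBlock_image_flip_right (x y : ℤ) :
    (horizontalBlock (x, y)).image (flip 1 (-1)) = horizontalBlock (x, -y - 1) := by
  ext ⟨u, v⟩
  simp [horizontalBlock, flip]
  omega

lemma verticalBlock_image_flip_right (x y : ℤ) :
    (verticalBlock (x, y)).image (flip 1 (-1)) = verticalBlock (x, -y - 2) := by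
  rw [← horizontalBlock_image_swap, image_flip_swap, horizontalBlock_image_flip_left,
    horizontalBlock_image_swap]

lemma verticalBlock_image_flip_left (x y : ℤ) :
    (verticalBlock (x, y)).image (flip (-1) 1) = verticalBlock (-x - 1, y) := by
  rw [← horizontalBlock_image_swap, image_flip_swap, horizontalBlock_image_flip_right,
    horizontalBlock_image_swap]

variable {S : Finset Cell} {x y : ℤ}

lemma mem_image_swap : (x, y) ∈ S.image Prod.swap ↔ (y, x) ∈ S :=
  gridSymm_swap.mem_image

lemma mem_image_flip {a b : ℤˣ} : (x, y) ∈ S.image (flip a b) ↔ (a * x, b * y) ∈ S :=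
  (gridSymm_flip a b).mem_image

lemma free_image_swap : Free (S.image Prod.swap) (x, y) ↔ Free S (y, x) := by
  simp only [Free, Finset.forall_mem_image, Prod.fst_swap, Prod.snd_swap, and_comm]

/-! ### Orthogonal convexity -/

lemma OrthConvex.col (h : OrthConvex S) {y₁ y₂ : ℤ} (h1 : (x, y₁) ∈ S) (h2 : (x, y₂) ∈ S)
    (hy1 : y₁ ≤ y) (hy2 : y ≤ y₂) : (x, y) ∈ S := by
  rcases hy1.eq_or_lt with rfl | hy1
  · exact h1
  rcases hy2.eq_or_lt with rfl | hy2
  · exact h2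
  exact h.1 x y₁ y₂ h1 h2 y hy1 hy2

lemma OrthConvex.row (h : OrthConvex S) {x₁ x₂ : ℤ} (h1 : (x₁, y) ∈ S) (h2 : (x₂, y) ∈ S)
    (hx1 : x₁ ≤ x) (hx2 : x ≤ x₂) : (x, y) ∈ S := by
  rcases hx1.eq_or_lt with rfl | hx1
  · exact h1
  rcases hx2.eq_or_lt with rfl | hx2
  · exact h2
  exact h.2 y x₁ x₂ h1 h2 x hx1 hx2

lemma OrthConvex.image_swap (h : OrthConvex S) : OrthConvex (S.image Prod.swap) := by
  refine ⟨fun x y₁ y₂ h1 h2 y hy1 hy2 => ?_, fun y x₁ x₂ h1 h2 x hx1 hx2 => ?_⟩ <;>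
    rw [mem_image_swap] at *
  · exact h.2 _ _ _ h1 h2 _ hy1 hy2
  · exact h.1 _ _ _ h1 h2 _ hx1 hx2

lemma OrthConvex.image_flip (h : OrthConvex S) (a b : ℤˣ) : OrthConvex (S.image (flip a b)) := by
  refine ⟨fun x y₁ y₂ h1 h2 y hy1 hy2 => ?_, fun y x₁ x₂ h1 h2 x hx1 hx2 => ?_⟩ <;>
    rw [mem_image_flip] at *
  · rcases Int.units_eq_one_or b with rfl | rfl
    · exact h.col h1 h2 (by simpa using hy1.le) (by simpa using hy2.le)
    · exact h.col h2 h1 (by simpa using hy2.le) (by simpa using hy1.le)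
  · rcases Int.units_eq_one_or a with rfl | rfl
    · exact h.row h1 h2 (by simpa using hx1.le) (by simpa using hx2.le)
    · exact h.row h2 h1 (by simpa using hx2.le) (by simpa using hx1.le)

/-- A connected shape crosses every cut that separates two of its cells. -/
lemma ConnectedShape.exists_adj (hS : ConnectedShape S) (P : Cell → Prop) {a b : Cell}
    (ha : a ∈ S) (hb : b ∈ S) (hPa : P a) (hPb : ¬ P b) :
    ∃ x y x' y', (x, y) ∈ S ∧ (x', y') ∈ S ∧ P (x, y) ∧ ¬ P (x', y') ∧
      ((x = x' ∧ (y = y' + 1 ∨ y' = y + 1)) ∨ (y = y' ∧ (x = x' + 1 ∨ x' = x + 1))) := by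
  obtain ⟨⟨x, y⟩, hu, ⟨x', y'⟩, hv, huv, h1, h2⟩ := (connectedShape_iff.1 hS).2 P a ha b hb hPa hPb
  exact ⟨x, y, x', y', hu, hv, h1, h2, grid_adj_iff.1 huv⟩

/-! ### The staircase in the upper right quadrant -/

/-- Only row `y - 1` is in question, and a node there would fill `(x + 1, y - 1)` by row convexity
with the floor. -/
lemma free_right_down (hconv : OrthConvex S) (hc : Free S (x, y)) (hf : (x, y - 1) ∈ S)
    (h : (x + 1, y - 1) ∉ S) : Free S (x + 1, y - 1) := by
  rintro ⟨u, v⟩ hs ⟨h1, h2⟩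
  have := hc _ hs
  simp only at h1 h2 this
  obtain rfl : v = y - 1 := by omega
  exact h (hconv.row hf hs (by omega) h1)

lemma free_left_up (hconv : OrthConvex S) (hc : Free S (x, y)) (hw : (x - 1, y) ∈ S)
    (h : (x - 1, y + 1) ∉ S) : Free S (x - 1, y + 1) := by
  have := free_right_down hconv.image_swap (free_image_swap.2 hc) (mem_image_swap.2 hw)
    (by rwa [mem_image_swap])
  exact free_image_swap.1 this

/-- A node in row `y - 1` to the right would be joined to the wall by a path that descends from row
`y` in a column left of `x`; row convexity would then fill `(x, y - 1)`. -/
lemma free_down (hS : ConnectedShape S) (hconv : OrthConvex S) (hc : Free S (x, y))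
    (hw : (x - 1, y) ∈ S) (h : (x, y - 1) ∉ S) : Free S (x, y - 1) := by
  rintro ⟨u, v⟩ hs ⟨h1, h2⟩
  have := hc _ hs
  simp only at h1 h2 this
  obtain rfl : v = y - 1 := by omega
  obtain ⟨a, b, a', b', ha, ha', hb, hb', hab⟩ :=
    hS.exists_adj (fun c => y ≤ c.2) hw hs (by simp) (by simp)
  have := hc _ ha
  simp only at this hb hb'
  obtain ⟨rfl, rfl⟩ : a = a' ∧ b' = y - 1 := by omega
  exact h (hconv.row ha' hs (by omega) h1)

/-- A path into column `x` or beyond must leave column `x - 1` below row `y - 1`; column convexity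
with the wall would then fill `(x - 1, y - 1)`. -/
lemma lt_of_not_wall (hS : ConnectedShape S) (hconv : OrthConvex S) (hc : Free S (x, y))
    (hd : Free S (x, y - 1)) (hw : (x - 1, y) ∈ S) (h : (x - 1, y - 1) ∉ S) :
    ∀ s ∈ S, s.1 < x := by
  intro s hs
  by_contra hsx
  obtain ⟨a, b, a', b', ha, ha', hb, hb', hab⟩ :=
    hS.exists_adj (fun c => c.1 < x) hw hs (by simp) hsx
  have := hc _ ha'
  have := hd _ ha'
  simp only at *
  obtain ⟨rfl, rfl⟩ : b = b' ∧ a = x - 1 := by omega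
  exact h (hconv.col ha hw (by omega) (by omega))

/-- Swapping the coordinates exchanges floor and wall and reverses the turn, so a wall of height at
least two may be treated as a floor. If both have length one, convexity frees the two parking cells.
-/
lemma reach_turn (hS : ConnectedShape S) (hconv : OrthConvex S) (hc : Free S (x, y))
    (hf : (x, y - 1) ∈ S) (hw : (x - 1, y) ∈ S) :
    Reach S {c | Free S c} (horizontalBlock (x, y)) (verticalBlock (x, y)) := by
  suffices main : ∀ (S : Finset Cell) (x y : ℤ), ConnectedShape S → OrthConvex S →
      Free S (x, y) → (x, y - 1) ∈ S → (x - 1, y) ∈ S →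
      (x + 1, y - 1) ∈ S ∨ (x - 1, y + 1) ∉ S →
      Reach S {c | Free S c} (horizontalBlock (x, y)) (verticalBlock (x, y)) by
    by_cases h : (x - 1, y + 1) ∈ S
    · have := main (S.image Prod.swap) y x (gridSymm_swap.connectedShape hS) hconv.image_swap
        (free_image_swap.2 hc) (mem_image_swap.2 hw) (mem_image_swap.2 hf)
        (Or.inl (mem_image_swap.2 h))
      have := this.image gridSymm_swap
      rw [gridSymm_swap.image_image, horizontalBlock_image_swap, verticalBlock_image_swap] at this
      refine (this.mono ?_).symm
      rintro ⟨u, v⟩ h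
      exact free_image_swap.1 h
    · exact main S x y hS hconv hc hf hw (Or.inr h)
  intro S x y hS hconv hc hf hw h
  by_cases h1 : (x + 1, y - 1) ∈ S
  · have e : x + 1 + 1 = x + 2 := by ring
    by_cases h2 : (x + 2, y - 1) ∈ S
    · exact reach_turn_of_floor_three hS hc hf h1 h2
    · have := free_right_down hconv (hc.mono (d := (x + 1, y)) (by simp) le_rfl) h1 (by rwa [e])
      rw [e] at this
      exact reach_turn_of_floor_two hS hc this hf h1 hw
  · have h2 : (x - 1, y + 1) ∉ S := h.resolve_left h1
    exact reach_turn_of_floor_one hS hc (free_right_down hconv hc hf h1)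
      (free_left_up hconv hc hw h2) hf hw

lemma reach_slide_down (hS : ConnectedShape S) (hd : Free S (x, y - 1))
    (h : (x - 1, y) ∈ S ∨ (x - 1, y + 1) ∈ S) :
    Reach S {c | Free S c} (verticalBlock (x, y)) (verticalBlock (x, y - 1)) := by
  have e1 : y - 1 + 1 = y := by ring
  have e2 : y - 1 + 2 = y + 1 := by ring
  have := reach_slide (gridSymm_swap.connectedShape hS) (free_image_swap.2 hd)
    (by rwa [mem_image_swap, mem_image_swap, e1, e2])
  have := this.image gridSymm_swap
  rw [gridSymm_swap.image_image, horizontalBlock_image_swap, horizontalBlock_image_swap, e1] at this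
  refine (this.mono ?_).symm
  rintro ⟨u, v⟩ h
  exact free_image_swap.1 h

/-- The lowest cell right of the last column of `S`. -/
structure IsEnd (S : Finset Cell) (x y : ℤ) : Prop where
  wall : (x - 1, y) ∈ S
  notMem : (x - 1, y - 1) ∉ S
  lt : ∀ s ∈ S, s.1 < x

lemma IsEnd.unique (hconv : OrthConvex S) {x' y' : ℤ} (h : IsEnd S x y) (h' : IsEnd S x' y') :
    x = x' ∧ y = y' := by
  have h1 := h.lt _ h'.wall
  have h2 := h'.lt _ h.wall
  obtain rfl : x = x' := by simp only at h1 h2; omega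
  refine ⟨rfl, ?_⟩
  by_contra hne
  rcases lt_or_gt_of_ne hne with hlt | hlt
  · exact h'.notMem (hconv.col h.wall h'.wall (by omega) (by omega))
  · exact h.notMem (hconv.col h'.wall h.wall (by omega) (by omega))

/-- Every advance down the staircase increases `x - y`, which contact with `S` bounds: a wall cell
gives `x - 1 - y ≤ C`, whence the `C + 1` in the measure. -/
lemma reach_end (hS : ConnectedShape S) (hconv : OrthConvex S) {C : ℤ}
    (hC : ∀ s ∈ S, s.1 - s.2 ≤ C) (n : ℕ) : ∀ x y, Free S (x, y) → C + 1 + y - x < n →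
    ((x, y - 1) ∈ S → ∃ u v, IsEnd S u v ∧
      Reach S {c | Free S c} (horizontalBlock (x, y)) (verticalBlock (u, v))) ∧
    ((x - 1, y) ∈ S → ∃ u v, IsEnd S u v ∧
      Reach S {c | Free S c} (verticalBlock (x, y)) (verticalBlock (u, v))) := by
  induction n with
  | zero =>
    intro x y _ hn
    refine ⟨fun h => ?_, fun h => ?_⟩ <;>
    · have := hC _ h
      simp at hn this
      omega
  | succ n ih =>
    intro x y hc hn
    push_cast at hn
    -- The floor case comes first because laying an upright block down in a concave corner leaves
    -- `(x, y)`, hence the measure, unchanged.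
    have floor : (x, y - 1) ∈ S → ∃ u v, IsEnd S u v ∧
        Reach S {c | Free S c} (horizontalBlock (x, y)) (verticalBlock (u, v)) := by
      intro hf
      by_cases h1 : (x + 1, y - 1) ∈ S
      · obtain ⟨u, v, he, hr⟩ :=
          (ih (x + 1) y (hc.mono (by simp) le_rfl) (by omega)).1 h1
        exact ⟨u, v, he, (reach_slide hS hc (Or.inl h1)).trans hr⟩
      · have hd := free_right_down hconv hc hf h1
        obtain ⟨u, v, he, hr⟩ := (ih (x + 1) (y - 1) hd (by omega)).2 (by simpa using hf)
        exact ⟨u, v, he, (reach_corner hS hc hd hf).trans hr⟩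
    refine ⟨floor, fun hw => ?_⟩
    by_cases hf : (x, y - 1) ∈ S
    · obtain ⟨u, v, he, hr⟩ := floor hf
      exact ⟨u, v, he, (reach_turn hS hconv hc hf hw).symm.trans hr⟩
    · have hd := free_down hS hconv hc hw hf
      by_cases h1 : (x - 1, y - 1) ∈ S
      · obtain ⟨u, v, he, hr⟩ := (ih x (y - 1) hd (by omega)).2 h1
        exact ⟨u, v, he, (reach_slide_down hS hd (Or.inl hw)).trans hr⟩
      · exact ⟨x, y, ⟨hw, h1, lt_of_not_wall hS hconv hc hd hw h1⟩, Relation.ReflTransGen.refl⟩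

/-! ### Connecting any two blocks of one quadrant -/

/-- The blocks above and to the right of `S` one of whose long sides touches `S`. -/
def IsUpperRightBlock (S A : Finset Cell) : Prop :=
  (∃ x y k, Free S (x, y) ∧ 0 ≤ k ∧ k ≤ 2 ∧ (x + k, y - 1) ∈ S ∧ A = horizontalBlock (x, y)) ∨
  (∃ x y k, Free S (x, y) ∧ 0 ≤ k ∧ k ≤ 2 ∧ (x - 1, y + k) ∈ S ∧ A = verticalBlock (x, y))

lemma IsUpperRightBlock.image_swap {A : Finset Cell} (h : IsUpperRightBlock S A) :
    IsUpperRightBlock (S.image Prod.swap) (A.image Prod.swap) := by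
  rcases h with ⟨x, y, k, h1, h2, h3, h4, rfl⟩ | ⟨x, y, k, h1, h2, h3, h4, rfl⟩
  · exact Or.inr ⟨y, x, k, free_image_swap.2 h1, h2, h3, mem_image_swap.2 h4,
      horizontalBlock_image_swap _ _⟩
  · exact Or.inl ⟨y, x, k, free_image_swap.2 h1, h2, h3, mem_image_swap.2 h4,
      verticalBlock_image_swap _ _⟩

lemma exists_reach_floor (hS : ConnectedShape S) (n : ℕ) : ∀ x y, Free S (x, y) → n ≤ 2 →
    (x + n, y - 1) ∈ S →
    Reach S {c | Free S c} (horizontalBlock (x, y)) (horizontalBlock (x + n, y)) := by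
  induction n with
  | zero =>
    intro x y _ _ _
    rw [Nat.cast_zero, add_zero]
    exact Relation.ReflTransGen.refl
  | succ n ih =>
    intro x y hc hn hf
    have e : x + 1 + n = x + (n + 1 : ℕ) := by push_cast; ring
    have := ih (x + 1) y (hc.mono (by simp) le_rfl) (by omega) (by rwa [e])
    rw [e] at this
    refine (reach_slide hS hc ?_).trans this
    obtain rfl | rfl : n = 0 ∨ n = 1 := by omega
    · exact Or.inl (by simpa using hf)
    · exact Or.inr (by simpa using hf)

lemma reach_floor (hS : ConnectedShape S) {k : ℤ} (hc : Free S (x, y)) (h0 : 0 ≤ k) (h2 : k ≤ 2)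
    (hf : (x + k, y - 1) ∈ S) :
    Reach S {c | Free S c} (horizontalBlock (x, y)) (horizontalBlock (x + k, y)) := by
  lift k to ℕ using h0
  exact exists_reach_floor hS k x y hc (by omega) hf

theorem reach_of_isUpperRightBlock (hS : ConnectedShape S) (hconv : OrthConvex S)
    {A B : Finset Cell} (hA : IsUpperRightBlock S A) (hB : IsUpperRightBlock S B) :
    Reach S {c | Free S c} A B := by
  obtain ⟨C, hC⟩ : ∃ C, ∀ s ∈ S, s.1 - s.2 ≤ C := by
    obtain ⟨C, hC⟩ := (S.image fun s => s.1 - s.2).exists_le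
    exact ⟨C, fun s hs => hC _ (Finset.mem_image_of_mem _ hs)⟩
  have key : ∀ A, IsUpperRightBlock S A → ∃ u v, IsEnd S u v ∧
      Reach S {c | Free S c} A (verticalBlock (u, v)) := by
    rintro A (⟨x, y, k, hc, h0, h2, hk, rfl⟩ | ⟨x, y, k, hc, h0, h2, hk, rfl⟩)
    · obtain ⟨u, v, he, hr⟩ := (reach_end hS hconv hC (C + 1 + y - (x + k) + 1).toNat (x + k) y
        (hc.mono (by simpa) le_rfl) (by omega)).1 hk
      exact ⟨u, v, he, (reach_floor hS hc h0 h2 hk).trans hr⟩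
    · obtain ⟨u, v, he, hr⟩ := (reach_end hS hconv hC (C + 1 + (y + k) - x + 1).toNat x (y + k)
        (hc.mono le_rfl (by simpa)) (by omega)).2 hk
      refine ⟨u, v, he, Reach.trans ?_ hr⟩
      have := (reach_floor (gridSymm_swap.connectedShape hS) (free_image_swap.2 hc) h0 h2
        (mem_image_swap.2 hk)).image gridSymm_swap
      rw [gridSymm_swap.image_image, horizontalBlock_image_swap, horizontalBlock_image_swap] at this
      refine this.mono ?_
      rintro ⟨u, v⟩ h
      exact free_image_swap.1 h
  obtain ⟨u, v, he, hA⟩ := key A hA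
  obtain ⟨u', v', he', hB⟩ := key B hB
  obtain ⟨rfl, rfl⟩ := he.unique hconv he'
  exact hA.trans hB.symm

end RotRobot

namespace RotRobot

variable {S A B : Finset Cell} {x y : ℤ}

/-! ### Unmarked cells -/

/-- The vertical rays up and down from the cell are infinite simple paths. Both meet `S`, so column
convexity puts the cell in `S`: there are no holes. -/
lemma mem_of_marked (hconv : OrthConvex S) {c : Cell} (hc : Marked S c) : c ∈ S := by
  obtain ⟨x, y⟩ := c
  by_contra hcS
  have ray : ∀ e : ℤ, e = 1 ∨ e = -1 → ∃ i : ℕ, (x, y + e * i) ∈ S := by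
    intro e he
    refine hc (fun i => (x, y + e * i)) (by simp) ?_ ?_
    · intro i j hij
      have h : y + e * i = y + e * j := congrArg Prod.snd hij
      rcases he with rfl | rfl <;> omega
    · intro i
      rw [grid_adj_iff]
      rcases he with rfl | rfl <;> simp <;> omega
  obtain ⟨i, hi⟩ := ray 1 (Or.inl rfl)
  obtain ⟨j, hj⟩ := ray (-1) (Or.inr rfl)
  exact hcS (hconv.col hj hi (by omega) (by omega))

lemma mem_perimeter (hconv : OrthConvex S) {s c : Cell} :
    (s, c) ∈ perimeter S ↔ s ∈ S ∧ c ∉ S ∧ grid.Adj s c := by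
  have : ∀ c, Marked S c ↔ c ∈ S := fun c =>
    ⟨mem_of_marked hconv, fun h γ h0 _ _ => ⟨0, by rwa [h0]⟩⟩
  simp only [perimeter, Set.mem_ofPred_eq, this]

/-! ### Blocks along the perimeter -/

/-- A `2 × 3` block in one of its orientations. -/
def IsBlock (A : Finset Cell) : Prop :=
  ∃ a, A = horizontalBlock a ∨ A = verticalBlock a

lemma IsBlock.image_swap (h : IsBlock A) : IsBlock (A.image Prod.swap) := by
  obtain ⟨⟨x, y⟩, rfl | rfl⟩ := h
  · exact ⟨_, Or.inr (horizontalBlock_image_swap x y)⟩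
  · exact ⟨_, Or.inl (verticalBlock_image_swap x y)⟩

lemma image_flip_one (A : Finset Cell) : A.image (flip 1 1) = A := by
  have : flip 1 1 = id := by funext c; simp [flip]
  rw [this, Finset.image_id]

lemma IsBlock.image_flip (h : IsBlock A) (a b : ℤˣ) : IsBlock (A.image (flip a b)) := by
  have key : ∀ {A}, IsBlock A → IsBlock (A.image (flip (-1) 1)) := by
    rintro A ⟨⟨x, y⟩, rfl | rfl⟩
    · exact ⟨_, Or.inl (horizontalBlock_image_flip_left x y)⟩
    · exact ⟨_, Or.inr (verticalBlock_image_flip_left x y)⟩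
  have key' : ∀ {A}, IsBlock A → IsBlock (A.image (flip 1 (-1))) := by
    intro A h
    have := (key h.image_swap).image_swap
    rwa [image_flip_swap, gridSymm_swap.image_image] at this
  rcases Int.units_eq_one_or a with rfl | rfl <;> rcases Int.units_eq_one_or b with rfl | rfl
  · rwa [image_flip_one]
  · exact key' h
  · exact key h
  · have := key' (key h)
    rwa [image_flip_flip] at this

/-- The blocks that touch `S` in the quadrant with signs `a` and `b`. -/
def IsQuadrantBlock (S : Finset Cell) (a b : ℤˣ) (A : Finset Cell) : Prop :=
  IsUpperRightBlock (S.image (flip a b)) (A.image (flip a b))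

lemma IsQuadrantBlock.of_image_flip {a b c d : ℤˣ}
    (h : IsQuadrantBlock (S.image (flip c d)) a b A) :
    IsQuadrantBlock S (a * c) (b * d) (A.image (flip c d)) := by
  unfold IsQuadrantBlock at h ⊢
  rwa [image_flip_flip, mul_assoc, mul_assoc, Int.units_mul_self, Int.units_mul_self, mul_one,
    mul_one, ← image_flip_flip]

lemma IsQuadrantBlock.of_image_swap {a b : ℤˣ}
    (h : IsQuadrantBlock (S.image Prod.swap) a b A) :
    IsQuadrantBlock S b a (A.image Prod.swap) := by
  unfold IsQuadrantBlock at h ⊢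
  have := h.image_swap
  rwa [image_flip_swap, gridSymm_swap.image_image, ← image_flip_swap] at this

/-- The blocks that touch `S` in some quadrant. -/
def IsTouchingBlock (S A : Finset Cell) : Prop :=
  ∃ a b, IsQuadrantBlock S a b A

lemma IsTouchingBlock.of_image_flip {a b : ℤˣ} (h : IsTouchingBlock (S.image (flip a b)) A) :
    IsTouchingBlock S (A.image (flip a b)) := by
  obtain ⟨c, d, h⟩ := h
  exact ⟨_, _, h.of_image_flip⟩

lemma IsTouchingBlock.of_image_swap (h : IsTouchingBlock (S.image Prod.swap) A) :
    IsTouchingBlock S (A.image Prod.swap) := by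
  obtain ⟨c, d, h⟩ := h
  exact ⟨_, _, h.of_image_swap⟩

/-- Going left from column `k`, every column up to that of `s` meets `S` below row `y`: an edge into
the next column at height `y` or more would, by column convexity, fill a cell of the empty row
segment. -/
lemma exists_low_left (hS : ConnectedShape S) (hconv : OrthConvex S) {k : ℤ} (n : ℕ)
    (hrow : ∀ j, k - n ≤ j → j ≤ k → (j, y) ∉ S) (hk : (k, y - 1) ∈ S) {s : Cell} (hs : s ∈ S)
    (hsn : s.1 ≤ k - n) : ∃ h < y, (k - n, h) ∈ S := by
  induction n with
  | zero => exact ⟨y - 1, by omega, by simpa using hk⟩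
  | succ n ih =>
    push_cast at *
    obtain ⟨h, hy, hh⟩ := ih (fun j h1 h2 => hrow j (by omega) h2) (by omega)
    obtain ⟨a, b, a', b', ha, ha', hb, hb', hab⟩ :=
      hS.exists_adj (fun c => c.1 ≤ k - (n + 1)) hs hh hsn (by simp only; omega)
    simp only at hb hb'
    obtain ⟨rfl, rfl, rfl⟩ : a = k - (n + 1) ∧ a' = k - n ∧ b = b' := by omega
    refine ⟨b, ?_, ha⟩
    by_contra hby
    exact hrow _ (by omega) (by omega) (hconv.col hh ha' hy.le (by omega))

lemma low_of_le (hS : ConnectedShape S) (hconv : OrthConvex S) {l r k : ℤ}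
    (hrow : ∀ j, l ≤ j → j ≤ r → (j, y) ∉ S) (hkr : k ≤ r) (hk : (k, y - 1) ∈ S)
    {u v : ℤ} (hs : (u, v) ∈ S) (hl : l ≤ u) (huk : u ≤ k) : v < y := by
  by_contra hv
  have e : k - ((k - u).toNat : ℤ) = u := by omega
  obtain ⟨h, hy, hh⟩ := exists_low_left hS hconv (k - u).toNat
    (fun j h1 h2 => hrow j (by omega) (by omega)) hk hs e.ge
  rw [e] at hh
  exact hrow u hl (by omega) (hconv.col hh hs hy.le (by omega))

lemma low_of_mem (hS : ConnectedShape S) (hconv : OrthConvex S) {l r k : ℤ}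
    (hrow : ∀ j, l ≤ j → j ≤ r → (j, y) ∉ S) (hlk : l ≤ k) (hkr : k ≤ r) (hk : (k, y - 1) ∈ S)
    {u v : ℤ} (hs : (u, v) ∈ S) (hl : l ≤ u) (hr : u ≤ r) : v < y := by
  rcases le_total u k with huk | huk
  · exact low_of_le hS hconv hrow hkr hk hs hl huk
  · refine low_of_le (l := -r) (r := -l) (k := -k) (u := -u) (S := S.image (flip (-1) 1))
      ((gridSymm_flip _ _).connectedShape hS) (hconv.image_flip _ _) ?_ (by omega) ?_ ?_
      (by omega) (by omega)
    · intro j h1 h2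
      rw [mem_image_flip]
      simpa using hrow (-j) (by omega) (by omega)
    · rw [mem_image_flip]; simpa using hk
    · rw [mem_image_flip]; simpa using hs

/-- In the columns from `l` to `r` all of `S` lies below row `y`. If there were nodes at height `y`
or more on both sides, take the lower of their two heights: the higher arm cannot descend past it
without row convexity bridging the gap, nor enter the columns of the gap above it, so it is cut off
from the floor. -/
lemma free_or_free (hS : ConnectedShape S) (hconv : OrthConvex S) {l r k : ℤ}
    (hrow : ∀ j, l ≤ j → j ≤ r → (j, y) ∉ S) (hlk : l ≤ k) (hkr : k ≤ r) (hk : (k, y - 1) ∈ S) :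
    Free S (l, y) ∨ Free (S.image (flip (-1) 1)) (-r, y) := by
  have low : ∀ {u v : ℤ}, (u, v) ∈ S → l ≤ u → u ≤ r → v < y :=
    fun hs hl hr => low_of_mem hS hconv hrow hlk hkr hk hs hl hr
  by_contra h
  simp only [not_or, Free, Finset.forall_mem_image, not_forall, not_not] at h
  obtain ⟨⟨⟨u, v⟩, hs, h1, h2⟩, ⟨⟨u', v'⟩, hs', h1', h2'⟩⟩ := h
  simp only [flip, Units.val_neg, Units.val_one, neg_mul, one_mul] at h1 h2 h1' h2'
  have hu : r < u := by
    by_contra hu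
    have := low hs h1 (by omega)
    omega
  have hu' : u' < l := by
    by_contra hu
    have := low hs' (by omega) (by omega)
    omega
  rcases le_total v v' with hv | hv
  · obtain ⟨a, b, a', b', ha, ha', hb, hb', hab⟩ :=
      hS.exists_adj (fun c => c.1 < l ∧ v ≤ c.2) hs' hk ⟨hu', hv⟩ (by simp; omega)
    simp only at hb hb'
    by_cases hal : a' < l
    · obtain rfl : b = v := by omega
      have := low (hconv.row ha hs hb.1.le (by omega)) le_rfl (by omega)
      omega
    · have := low ha' (by omega) (by omega)
      omega
  · obtain ⟨a, b, a', b', ha, ha', hb, hb', hab⟩ :=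
      hS.exists_adj (fun c => r < c.1 ∧ v' ≤ c.2) hs hk ⟨hu, hv⟩ (by simp; omega)
    simp only at hb hb'
    by_cases hal : r < a'
    · obtain rfl : b = v' := by omega
      have := low (hconv.row hs' ha (by omega) hb.1.le) (by omega) le_rfl
      omega
    · have := low ha' (by omega) (by omega)
      omega

lemma isTouchingBlock_of_floor (hS : ConnectedShape S) (hconv : OrthConvex S)
    (hd : Disjoint S (horizontalBlock (x, y))) {k : ℤ} (h0 : 0 ≤ k) (h2 : k ≤ 2)
    (hk : (x + k, y - 1) ∈ S) : IsTouchingBlock S (horizontalBlock (x, y)) := by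
  have hrow : ∀ j, x ≤ j → j ≤ x + 2 → (j, y) ∉ S := by
    intro j h1 h2
    refine Finset.disjoint_right.1 hd ?_
    obtain rfl | rfl | rfl : j = x ∨ j = x + 1 ∨ j = x + 2 := by omega
    all_goals simp [horizontalBlock]
  rcases free_or_free hS hconv hrow (by omega) (by omega) hk with h | h
  · refine ⟨1, 1, Or.inl ⟨x, y, k, ?_, h0, h2, ?_, ?_⟩⟩
    · rwa [image_flip_one]
    · rwa [image_flip_one]
    · rw [image_flip_one]
  -- Reflection reverses the three columns: the new lower left cell comes from `(x + 2, y)`, and the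
  -- contact offset `k` becomes `2 - k`.
  · refine ⟨-1, 1, Or.inl ⟨-x - 2, y, 2 - k, ?_, by omega, by omega, ?_, ?_⟩⟩
    · rwa [show -x - 2 = -(x + 2) by ring]
    · rw [mem_image_flip]
      convert hk using 2 <;> simp; ring
    · exact horizontalBlock_image_flip_left x y

lemma isTouchingBlock_of_disjoint (hS : ConnectedShape S) (hconv : OrthConvex S)
    (hd : Disjoint S (horizontalBlock (x, y))) {s c : Cell} (hs : s ∈ S)
    (hc : c ∈ horizontalBlock (x, y)) (hadj : grid.Adj s c) (hsc : s.1 = c.1) :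
    IsTouchingBlock S (horizontalBlock (x, y)) := by
  have hs' := Finset.disjoint_left.1 hd hs
  rw [grid_adj_iff] at hadj
  obtain ⟨u, v⟩ := s
  have : (v = y - 1 ∨ v = y + 2) ∧ x ≤ u ∧ u ≤ x + 2 := by
    simp only [horizontalBlock, Finset.mem_insert, Finset.mem_singleton, Prod.ext_iff] at hc hs'
    simp only at hadj hsc
    omega
  obtain ⟨rfl | rfl, h1, h2⟩ := this
  · exact isTouchingBlock_of_floor hS hconv hd (k := u - x) (by omega) (by omega)
      (by rwa [add_sub_cancel])
  · have e := horizontalBlock_image_flip_right x y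
    have := isTouchingBlock_of_floor (S := S.image (flip 1 (-1))) (x := x) (y := -y - 1)
      ((gridSymm_flip _ _).connectedShape hS) (hconv.image_flip _ _)
      (by rw [← e]; exact (Finset.disjoint_image (gridSymm_flip _ _).injective).2 hd)
      (k := u - x) (by omega) (by omega)
      (by rw [mem_image_flip]; convert hs using 2 <;> simp; ring)
    have := this.of_image_flip
    rwa [← e, (gridSymm_flip _ _).image_image] at this

theorem isTouchingBlock_of_liesAlongPerimeter (hS : ConnectedShape S) (hconv : OrthConvex S)
    {p : Fin 6 → Cell} (hp : LiesAlongPerimeter S p) : IsTouchingBlock S (nodes p) := by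
  obtain ⟨hd, ⟨⟨x, y⟩, ha, s, c, hsc, hc, h1⟩ | ⟨⟨x, y⟩, ha, s, c, hsc, hc, h1⟩⟩ := hp <;>
    rw [ha] at hd hc ⊢ <;> rw [mem_perimeter hconv] at hsc
  · exact isTouchingBlock_of_disjoint hS hconv hd hsc.1 hc hsc.2.2 h1
  · have e := verticalBlock_image_swap x y
    have := isTouchingBlock_of_disjoint (S := S.image Prod.swap) (x := y) (y := x)
      (s := s.swap) (c := c.swap)
      (gridSymm_swap.connectedShape hS) hconv.image_swap
      (by rw [← e]; exact (Finset.disjoint_image gridSymm_swap.injective).2 hd)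
      (Finset.mem_image_of_mem _ hsc.1) (by rw [← e]; exact Finset.mem_image_of_mem _ hc)
      (gridSymm_swap.adj _ _ hsc.2.2) h1
    have := this.of_image_swap
    rwa [← e, gridSymm_swap.image_image] at this

lemma exists_block_of_floor (hS : ConnectedShape S) (hconv : OrthConvex S) (hc : (x, y) ∉ S)
    (hf : (x, y - 1) ∈ S) : ∃ A, IsBlock A ∧ (x, y) ∈ A ∧ IsTouchingBlock S A := by
  rcases free_or_free hS hconv (l := x) (r := x) (k := x)
    (fun j h1 h2 => by rwa [le_antisymm h2 h1]) le_rfl le_rfl hf with h | h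
  · refine ⟨horizontalBlock (x, y), ⟨_, Or.inl rfl⟩, by simp [horizontalBlock],
      1, 1, Or.inl ⟨x, y, 0, ?_, le_rfl, by omega, ?_, ?_⟩⟩ <;> rw [image_flip_one]
    · exact h
    · simpa using hf
  · refine ⟨(horizontalBlock (-x, y)).image (flip (-1) 1), IsBlock.image_flip ⟨_, Or.inl rfl⟩ _ _,
      ?_, -1, 1, Or.inl ⟨-x, y, 0, h, le_rfl, by omega, ?_, ?_⟩⟩
    · rw [mem_image_flip]
      simp [horizontalBlock]
    · rw [mem_image_flip]
      simpa using hf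
    · exact (gridSymm_flip _ _).image_image _

theorem exists_block_of_adj (hS : ConnectedShape S) (hconv : OrthConvex S) {s c : Cell}
    (hs : s ∈ S) (hc : c ∉ S) (h : grid.Adj s c) :
    ∃ A, IsBlock A ∧ c ∈ A ∧ IsTouchingBlock S A := by
  have vert : ∀ {S : Finset Cell}, ConnectedShape S → OrthConvex S → ∀ {s c : Cell}, s ∈ S →
      c ∉ S → grid.Adj s c → s.1 = c.1 → ∃ A, IsBlock A ∧ c ∈ A ∧ IsTouchingBlock S A := by
    rintro S hS hconv ⟨u, v⟩ ⟨x, y⟩ hs hc h h1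
    rw [grid_adj_iff] at h
    simp only at h h1
    obtain ⟨rfl, rfl | rfl⟩ : u = x ∧ (v = y - 1 ∨ v = y + 1) := by omega
    · exact exists_block_of_floor hS hconv hc hs
    · obtain ⟨A, hA, hcA, ht⟩ := exists_block_of_floor (S := S.image (flip 1 (-1))) (x := u)
        (y := -y) ((gridSymm_flip _ _).connectedShape hS) (hconv.image_flip _ _)
        (by rw [mem_image_flip]; simpa using hc)
        (by rw [mem_image_flip]; convert hs using 2 <;> simp; ring)
      refine ⟨A.image (flip 1 (-1)), hA.image_flip _ _, ?_, ht.of_image_flip⟩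
      rw [mem_image_flip]
      simpa using hcA
  rcases grid_adj_iff.1 h with h1 | h1
  · exact vert hS hconv hs hc h h1.1
  · obtain ⟨A, hA, hcA, ht⟩ := vert (gridSymm_swap.connectedShape hS) hconv.image_swap
      (s := s.swap) (c := c.swap) (Finset.mem_image_of_mem _ hs)
      (by rw [gridSymm_swap.mem_image, Prod.swap_swap]; exact hc) (gridSymm_swap.adj _ _ h) h1.1
    exact ⟨A.image Prod.swap, hA.image_swap, by rwa [gridSymm_swap.mem_image], ht.of_image_swap⟩

/-! ### The circuit -/

/-- The cells that lie above (`b = 1`) or below (`b = -1`) all cells of `S` in their column. -/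
def side (S : Finset Cell) (b : ℤˣ) : Set Cell :=
  {c | ∀ s ∈ S, s.1 = c.1 → b * s.2 < b * c.2}

/-- Freeness is weakened to `side`, which forgets left and right, so that walks through both
quadrants of one side can be concatenated. -/
lemma reach_of_isQuadrantBlock (hS : ConnectedShape S) (hconv : OrthConvex S) {a b : ℤˣ}
    (hA : IsQuadrantBlock S a b A) (hB : IsQuadrantBlock S a b B) : Reach S (side S b) A B := by
  have := (reach_of_isUpperRightBlock ((gridSymm_flip a b).connectedShape hS)
    (hconv.image_flip a b) hA hB).image (gridSymm_flip a b)
  simp only [(gridSymm_flip a b).image_image] at this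
  refine this.mono fun c hc s hs hsc => ?_
  have := hc _ (Finset.mem_image_of_mem _ hs)
  simp only [flip, hsc, le_refl, true_and, not_le] at this
  exact this

lemma exists_right_block (hS : ConnectedShape S) : ∃ E, IsBlock E ∧
    (∀ c ∈ E, ∀ s ∈ S, s.1 < c.1) ∧ ∀ b, IsQuadrantBlock S 1 b E := by
  obtain ⟨⟨m, r⟩, hm, hmax⟩ := S.exists_max_image Prod.fst (connectedShape_iff.1 hS).1
  have key : ∀ {S : Finset Cell} {m r : ℤ}, (m, r) ∈ S → (∀ s ∈ S, s.1 ≤ m) →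
      IsUpperRightBlock S (verticalBlock (m + 1, r - 1)) := by
    intro S m r hm hmax
    -- Contact in the middle row makes the block symmetric about row `r`, so the vertical reflection
    -- yields a block of the same form.
    refine Or.inr ⟨m + 1, r - 1, 1, ?_, by omega, by omega, by simpa using hm, rfl⟩
    intro s hs h
    have := hmax s hs
    simp only at h
    omega
  refine ⟨verticalBlock (m + 1, r - 1), ⟨_, Or.inr rfl⟩, ?_, fun b => ?_⟩
  · intro c hc s hs
    have := hmax s hs
    simp only [verticalBlock, Finset.mem_insert, Finset.mem_singleton, Prod.ext_iff] at hc
    omega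
  · unfold IsQuadrantBlock
    rcases Int.units_eq_one_or b with rfl | rfl
    · rw [image_flip_one, image_flip_one]
      exact key hm hmax
    · have := key (S := S.image (flip 1 (-1))) (m := m) (r := -r)
        (by rw [mem_image_flip]; simpa using hm)
        (Finset.forall_mem_image.2 (by simpa [flip] using hmax))
      rw [verticalBlock_image_flip_right]
      convert this using 3
      ring

lemma exists_left_block (hS : ConnectedShape S) : ∃ W, IsBlock W ∧
    (∀ c ∈ W, ∀ s ∈ S, c.1 < s.1) ∧ ∀ b, IsQuadrantBlock S (-1) b W := by
  obtain ⟨E, hE, hlt, hq⟩ := exists_right_block ((gridSymm_flip (-1) 1).connectedShape hS)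
  refine ⟨E.image (flip (-1) 1), hE.image_flip _ _, ?_, fun b => ?_⟩
  · intro c hc s hs
    have := hlt _ ((gridSymm_flip _ _).mem_image.1 hc) _ (Finset.mem_image_of_mem _ hs)
    simp only [flip, Units.val_neg, Units.val_one] at this
    omega
  · simpa using (hq b).of_image_flip

lemma exists_upper_block (hS : ConnectedShape S) : ∃ N, ∀ a, IsQuadrantBlock S a 1 N := by
  obtain ⟨E, -, -, hq⟩ := exists_right_block (gridSymm_swap.connectedShape hS)
  exact ⟨E.image Prod.swap, fun a => (hq a).of_image_swap⟩

lemma exists_side_block (hS : ConnectedShape S) (b : ℤˣ) : ∃ N, ∀ a, IsQuadrantBlock S a b N := by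
  obtain ⟨N, hN⟩ := exists_upper_block ((gridSymm_flip 1 b).connectedShape hS)
  exact ⟨N.image (flip 1 b), fun a => by simpa using (hN a).of_image_flip⟩

/-- Starting from a block left of `S`, the robot reaches a block right of `S` along both sides,
and every block that touches `S` along one of the sides. -/
theorem exists_circuit (hS : ConnectedShape S) (hconv : OrthConvex S) : ∃ W E,
    IsBlock W ∧ (∀ c ∈ W, ∀ s ∈ S, c.1 < s.1) ∧ (∀ c ∈ E, ∀ s ∈ S, s.1 < c.1) ∧
    (∀ b, Reach S (side S b) W E) ∧
    ∀ A, IsTouchingBlock S A → ∃ b, Reach S (side S b) W A := by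
  obtain ⟨W, hW, hlt, hWq⟩ := exists_left_block hS
  obtain ⟨E, -, hlt', hEq⟩ := exists_right_block hS
  have hWE : ∀ b, Reach S (side S b) W E := by
    intro b
    obtain ⟨N, hN⟩ := exists_side_block hS b
    exact (reach_of_isQuadrantBlock hS hconv (hWq b) (hN _)).trans
      (reach_of_isQuadrantBlock hS hconv (hN _) (hEq b))
  refine ⟨W, E, hW, hlt, hlt', hWE, ?_⟩
  rintro A ⟨a, b, hA⟩
  refine ⟨b, ?_⟩
  rcases Int.units_eq_one_or a with rfl | rfl
  · exact (hWE b).trans (reach_of_isQuadrantBlock hS hconv (hEq b) hA)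
  · exact reach_of_isQuadrantBlock hS hconv (hWq b) hA

end RotRobot

namespace RotRobot

variable {S A B : Finset Cell}

/-! ### Runs of the labelled robot -/

lemma IsRobotRun.concat {T₁ T₂ : ℕ} {q₁ q₂ : ℕ → Fin 6 → Cell} (h₁ : IsRobotRun S T₁ q₁)
    (h₂ : IsRobotRun S T₂ q₂) (h : q₁ T₁ = q₂ 0) : ∃ q, (∀ t ≤ T₁, q t = q₁ t) ∧
      (∀ t, q (T₁ + t) = q₂ t) ∧ IsRobotRun S (T₁ + T₂) q ∧
      ∀ s i, turns s (T₁ + T₂) q i = turns s T₁ q₁ i + turns s T₂ q₂ i := by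
  let q : ℕ → Fin 6 → Cell := fun t => if t ≤ T₁ then q₁ t else q₂ (t - T₁)
  have hq₁ : ∀ t ≤ T₁, q t = q₁ t := fun t ht => if_pos ht
  have hq₂ : ∀ t, q (T₁ + t) = q₂ t := by
    intro t
    rcases Nat.eq_zero_or_pos t with rfl | ht
    · rw [add_zero, hq₁ T₁ le_rfl, h]
    · simp only [q]
      rw [if_neg (by omega), Nat.add_sub_cancel_left]
  refine ⟨q, hq₁, hq₂, ⟨fun t ht => ?_, fun t ht => ?_⟩, fun s i => ?_⟩
  · rcases lt_or_ge t T₁ with h | h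
    · rw [hq₁ t h.le, hq₁ (t + 1) h]
      exact h₁.step t h
    · obtain ⟨r, rfl⟩ := Nat.exists_eq_add_of_le h
      rw [hq₂ r, add_assoc, hq₂ (r + 1)]
      exact h₂.step r (by omega)
  · rcases le_total t T₁ with h | h
    · rw [hq₁ t h]
      exact h₁.connected t h
    · obtain ⟨r, rfl⟩ := Nat.exists_eq_add_of_le h
      rw [hq₂ r]
      exact h₂.connected r (by omega)
  · simp only [turns, Finset.sum_range_add]
    congr 1
    · refine Finset.sum_congr rfl fun t ht => ?_
      have ht := Finset.mem_range.1 ht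
      rw [hq₁ t ht.le, hq₁ (t + 1) ht]
    · refine Finset.sum_congr rfl fun t _ => ?_
      rw [hq₂ t, add_assoc, hq₂ (t + 1)]

/-- The position of `c` relative to `s` that determines the turns of a robot that stays on the
side `b` of `S`: crossings of the vertical line next to `s` only count on the upper side. -/
def lap (b : ℤˣ) (s c : Cell) : ℤ :=
  if b = 1 ∧ s.1 < c.1 then 1 else 0

lemma crossing_self (s c : Cell) : crossing s c c = 0 := by
  unfold crossing
  split_ifs <;> omega

/-- When the line next to `s` is passed, one of the two cells is in the column of `s`, hence
strictly above or below `s`. The other differs from it by one in height, so the midpoint is on the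
same side of `s`: the crossing counts above and not below. -/
lemma crossing_eq {b : ℤˣ} {s u w : Cell} (hs : s ∈ S) (hu : u ∈ side S b) (hw : w ∈ side S b)
    (h1 : u.1 = w.1 + 1 ∨ w.1 = u.1 + 1) (h2 : u.2 = w.2 + 1 ∨ w.2 = u.2 + 1) :
    crossing s u w = lap b s w - lap b s u := by
  have hu := hu s hs
  have hw := hw s hs
  rcases Int.units_eq_one_or b with rfl | rfl
  · simp only [Units.val_one, one_mul] at hu hw
    simp only [crossing, lap, true_and]
    split_ifs <;> omega
  · simp only [Units.val_neg, Units.val_one, neg_mul, one_mul] at hu hw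
    have h : ¬ ((-1 : ℤˣ) = 1) := by decide
    simp only [crossing, lap, h, false_and, if_false]
    split_ifs <;> omega

lemma nodes_update {p : Fin 6 → Cell} (hp : Function.Injective p) (i : Fin 6) (w : Cell) :
    nodes (Function.update p i w) = insert w ((nodes p).erase (p i)) := by
  ext c
  simp only [nodes, Finset.mem_image, Finset.mem_univ, true_and, Finset.mem_insert,
    Finset.mem_erase]
  constructor
  · rintro ⟨j, rfl⟩
    rcases eq_or_ne j i with rfl | h
    · simp
    · rw [Function.update_of_ne h]
      exact Or.inr ⟨fun e => h (hp e), j, rfl⟩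
  · rintro (rfl | ⟨h, j, rfl⟩)
    · exact ⟨i, by simp⟩
    · exact ⟨j, Function.update_of_ne (fun e => h (by rw [e])) _ _⟩

lemma injective_of_card_nodes {p : Fin 6 → Cell} (h : (nodes p).card = 6) :
    Function.Injective p := by
  rw [← Set.injOn_univ, ← Finset.coe_univ]
  exact Finset.card_image_iff.1 (by simpa [nodes] using h)

lemma exists_nodes_eq (hA : A.card = 6) : ∃ p : Fin 6 → Cell, nodes p = A := by
  refine ⟨fun i => (A.equivFinOfCardEq hA).symm i, ?_⟩
  ext c
  simp only [nodes, Finset.mem_image, Finset.mem_univ, true_and]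
  exact ⟨fun ⟨i, hi⟩ => hi ▸ Finset.coe_mem _,
    fun hc => ⟨A.equivFinOfCardEq hA ⟨c, hc⟩, by simp⟩⟩

lemma Move.exists_run {b : ℤˣ} (h : Move S (side S b) A B) (hA : A.card = 6) {p : Fin 6 → Cell}
    (hp : nodes p = A) : ∃ q, q 0 = p ∧ nodes (q 1) = B ∧ IsRobotRun S 1 q ∧
      ∀ s ∈ S, ∀ i, turns s 1 q i = lap b s (q 1 i) - lap b s (p i) := by
  obtain ⟨u, v, w, hu, huS, hv, huv, hvw, h1, h2, hw, hz, huR, hwR, rfl, hc, hc'⟩ := h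
  have hinj := injective_of_card_nodes (by rw [hp, hA])
  subst hp
  obtain ⟨i, -, rfl⟩ := Finset.mem_image.1 hu
  have hn := nodes_update hinj i w
  refine ⟨fun t => if t = 0 then p else Function.update p i w, rfl, hn, ⟨?_, ?_⟩, ?_⟩
  · intro t ht
    obtain rfl : t = 0 := by omega
    exact ⟨i, w, ⟨Finset.mem_union_right _ hu, v, hv, huv, hvw, h1, h2, hw, hz⟩, rfl⟩
  · intro t ht
    obtain rfl | rfl : t = 0 ∨ t = 1 := by omega
    · exact hc
    · simpa only [one_ne_zero, if_false, hn] using hc'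
  · intro s hs j
    simp only [turns, Finset.sum_range_one, zero_add, one_ne_zero, if_true, if_false]
    rcases eq_or_ne j i with rfl | hj
    · rw [Function.update_self]
      rw [grid_adj_iff] at huv hvw
      exact crossing_eq hs huR hwR (by omega) (by omega)
    · rw [Function.update_of_ne hj, crossing_self, sub_self]

lemma Reach.card_eq {R : Set Cell} (h : Reach S R A B) : B.card = A.card := by
  induction h with
  | refl => rfl
  | tail _ h ih => rw [h.card_eq, ih]

lemma Reach.exists_run {b : ℤˣ} (h : Reach S (side S b) A B) (hA : A.card = 6)
    (hconn : ConnectedShape (S ∪ A)) {p : Fin 6 → Cell} (hp : nodes p = A) :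
    ∃ T q, q 0 = p ∧ nodes (q T) = B ∧ IsRobotRun S T q ∧
      ∀ s ∈ S, ∀ i, turns s T q i = lap b s (q T i) - lap b s (p i) := by
  induction h with
  | refl =>
    refine ⟨0, fun _ => p, rfl, hp, ⟨by simp, fun t _ => by rwa [hp]⟩, ?_⟩
    simp [turns]
  | @tail C D hr h ih =>
    obtain ⟨T, q, h0, hT, hrun, hturn⟩ := ih
    have hC : C.card = 6 := by rw [Reach.card_eq hr, hA]
    obtain ⟨q', h0', h1', hrun', hturn'⟩ := h.exists_run hC hT
    obtain ⟨q'', e1, e2, hrun'', hturn''⟩ := hrun.concat hrun' h0'.symm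
    refine ⟨T + 1, q'', by rw [e1 0 (Nat.zero_le _), h0], by rw [e2 1, h1'], hrun'', ?_⟩
    intro s hs i
    rw [hturn'', hturn s hs, hturn' s hs, e2 1]
    ring

/-! ### Composing labelled runs into tours -/

/-- Wherever its six nodes are placed on `A`, the robot can move to `B` such that each node makes
at least `m` turns around each cell of `S`, and the cells of `C` are covered on the way. -/
def Tour (S : Finset Cell) (m : ℤ) (C : Set Cell) (A B : Finset Cell) : Prop :=
  ∀ p : Fin 6 → Cell, nodes p = A → ∃ T q, q 0 = p ∧ nodes (q T) = B ∧ IsRobotRun S T q ∧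
    (∀ s ∈ S, ∀ i, m ≤ turns s T q i) ∧ ∀ c ∈ C, ∃ t ≤ T, IsSixRobot (q t) ∧ c ∈ nodes (q t)

lemma Tour.trans {m n : ℤ} {C D : Set Cell} {A B E : Finset Cell} (h : Tour S m C A B)
    (h' : Tour S n D B E) : Tour S (m + n) (C ∪ D) A E := by
  intro p hp
  obtain ⟨T, q, h0, hT, hrun, hturn, hcov⟩ := h p hp
  obtain ⟨T', q', h0', hT', hrun', hturn', hcov'⟩ := h' (q T) hT
  obtain ⟨q'', e1, e2, hrun'', hturn''⟩ := hrun.concat hrun' h0'.symm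
  refine ⟨T + T', q'', by rw [e1 0 (Nat.zero_le _), h0], by rw [e2, hT'], hrun'', ?_, ?_⟩
  · intro s hs i
    rw [hturn'']
    exact add_le_add (hturn s hs i) (hturn' s hs i)
  · rintro c (hc | hc)
    · obtain ⟨t, ht, h⟩ := hcov c hc
      exact ⟨t, by omega, by rwa [e1 t ht]⟩
    · obtain ⟨t, ht, h⟩ := hcov' c hc
      exact ⟨T + t, by omega, by rwa [e2 t]⟩

lemma Tour.refl (hconn : ConnectedShape (S ∪ A)) : Tour S 0 ∅ A A := by
  intro p hp
  exact ⟨0, fun _ => p, rfl, hp, ⟨by simp, fun t _ => by rwa [hp]⟩, by simp [turns], by simp⟩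

/-- A tour of length zero, spliced between two walks, records that the block formation covers its
cells at that moment. -/
lemma IsBlock.tour (hA : IsBlock A) (hconn : ConnectedShape (S ∪ A)) : Tour S 0 A A A := by
  intro p hp
  refine ⟨0, fun _ => p, rfl, hp, ⟨by simp, fun t _ => by rwa [hp]⟩, by simp [turns], ?_⟩
  intro c hc
  exact ⟨0, le_rfl, by rwa [IsSixRobot, hp], by rwa [hp]⟩

lemma lap_nonneg (b : ℤˣ) (s c : Cell) : 0 ≤ lap b s c := by
  unfold lap
  split_ifs <;> simp

lemma lap_le_one (b : ℤˣ) (s c : Cell) : lap b s c ≤ 1 := by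
  unfold lap
  split_ifs <;> simp

lemma Reach.tour {b : ℤˣ} (h : Reach S (side S b) A B) (hA : A.card = 6)
    (hconn : ConnectedShape (S ∪ A)) : Tour S (-1) ∅ A B := by
  intro p hp
  obtain ⟨T, q, h0, hT, hrun, hturn⟩ := h.exists_run hA hconn hp
  refine ⟨T, q, h0, hT, hrun, fun s hs i => ?_, by simp⟩
  rw [hturn s hs i]
  linarith [lap_nonneg b s (q T i), lap_le_one b s (p i)]

/-- Along the upper side each node passes from `lap` value 0 to 1, because `W` and `E` lie strictly
to the left and right of `S`; on the way back below, `lap` is constantly 0. -/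
lemma tour_circuit {W E : Finset Cell} (hW : W.card = 6) (hconn : ConnectedShape (S ∪ W))
    (hWS : ∀ c ∈ W, ∀ s ∈ S, c.1 < s.1) (hES : ∀ c ∈ E, ∀ s ∈ S, s.1 < c.1)
    (h : ∀ b, Reach S (side S b) W E) : Tour S 1 ∅ W W := by
  have hE : E.card = 6 := by rw [(h 1).card_eq, hW]
  have mem : ∀ (p : Fin 6 → Cell) i, p i ∈ nodes p := fun p i =>
    Finset.mem_image_of_mem _ (Finset.mem_univ i)
  have up : Tour S 1 ∅ W E := by
    intro p hp
    obtain ⟨T, q, h0, hT, hrun, hturn⟩ := (h 1).exists_run hW hconn hp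
    refine ⟨T, q, h0, hT, hrun, fun s hs i => ?_, by simp⟩
    have h1 := hWS (p i) (hp ▸ mem p i) s hs
    have h2 := hES (q T i) (hT ▸ mem (q T) i) s hs
    rw [hturn s hs i, lap, lap, if_pos ⟨rfl, h2⟩, if_neg (fun h => absurd h.2 h1.not_gt)]
    simp
  have hconnE : ConnectedShape (S ∪ E) := by
    obtain ⟨p, hp⟩ := exists_nodes_eq hW
    obtain ⟨T, q, -, hT, hrun, -⟩ := up p hp
    exact hT ▸ hrun.connected T le_rfl
  have down : Tour S 0 ∅ E W := by
    intro p hp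
    obtain ⟨T, q, h0, hT, hrun, hturn⟩ := (h (-1)).symm.exists_run hE hconnE hp
    refine ⟨T, q, h0, hT, hrun, fun s hs i => ?_, by simp⟩
    rw [hturn s hs i]
    simp [lap]
  simpa using up.trans down

lemma exists_tour_cover {W : Finset Cell} (hconn : ConnectedShape (S ∪ W))
    (C : Finset Cell) (h : ∀ c ∈ C, ∃ (A : Finset Cell) (m n : ℤ), c ∈ A ∧ Tour S 0 A A A ∧
      Tour S m ∅ W A ∧ Tour S n ∅ A W) : ∃ m, Tour S m C W W := by
  classical
  induction C using Finset.induction_on with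
  | empty => exact ⟨0, by simpa using Tour.refl hconn⟩
  | insert c C _ ih =>
    obtain ⟨k, hk⟩ := ih fun c hc => h c (Finset.mem_insert_of_mem hc)
    obtain ⟨A, m, n, hcA, h1, h2, h3⟩ := h c (Finset.mem_insert_self _ _)
    -- One more excursion from `W` to `A` and back is appended; the bound on turns may become
    -- negative, but it exists.
    refine ⟨k + (m + 0 + n), fun p hp => ?_⟩
    obtain ⟨T, q, h0, hT, hrun, hturn, hcov⟩ := (hk.trans ((h2.trans h1).trans h3)) p hp
    refine ⟨T, q, h0, hT, hrun, hturn, fun d hd => hcov d ?_⟩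
    rcases Finset.mem_insert.1 hd with rfl | hd
    · exact Or.inr (Or.inl (Or.inr hcA))
    · exact Or.inl hd

lemma Tour.iterate {W : Finset Cell} (hconn : ConnectedShape (S ∪ W)) (h : Tour S 1 ∅ W W)
    (n : ℕ) : Tour S n ∅ W W := by
  induction n with
  | zero => exact_mod_cast Tour.refl hconn
  | succ n ih => simpa using ih.trans h

lemma IsBlock.card_eq (hA : IsBlock A) : A.card = 6 := by
  have key : ∀ a, (horizontalBlock a).card = 6 := by
    rintro ⟨x, y⟩
    unfold horizontalBlock
    repeat rw [Finset.card_insert_of_notMem (by simp [Prod.ext_iff])]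
    simp
  obtain ⟨⟨x, y⟩, rfl | rfl⟩ := hA
  · exact key _
  · rw [← horizontalBlock_image_swap, Finset.card_image_of_injective _ Prod.swap_injective, key]

end RotRobot

namespace RotRobot

variable {S A : Finset Cell}

/-! ### The traversal -/

lemma IsUpperRightBlock.connectedShape (hS : ConnectedShape S) (h : IsUpperRightBlock S A) :
    ConnectedShape (S ∪ A) := by
  have key : ∀ {S : Finset Cell} {x y k : ℤ}, ConnectedShape S → 0 ≤ k → k ≤ 2 →
      (x + k, y - 1) ∈ S → ConnectedShape (S ∪ horizontalBlock (x, y)) := by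
    intro S x y k hS h0 h2 hk
    have e := place_flat x y 0 0
    simp only [add_zero] at e
    rw [← e]
    refine connectedShape_of_attached (K := [(k, -1)]) hS
      (by simpa [← sub_eq_add_neg] using hk) ?_
    obtain rfl | rfl | rfl : k = 0 ∨ k = 1 ∨ k = 2 := by omega
    all_goals decide +kernel
  rcases h with ⟨x, y, k, -, h0, h2, hk, rfl⟩ | ⟨x, y, k, -, h0, h2, hk, rfl⟩
  · exact key hS h0 h2 hk
  · have := gridSymm_swap.connectedShape
      (key (gridSymm_swap.connectedShape hS) h0 h2 (mem_image_swap.2 hk))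
    rwa [Finset.image_union, gridSymm_swap.image_image, horizontalBlock_image_swap] at this

lemma IsTouchingBlock.connectedShape (hS : ConnectedShape S) (h : IsTouchingBlock S A) :
    ConnectedShape (S ∪ A) := by
  obtain ⟨a, b, h⟩ := h
  have hg := gridSymm_flip a b
  have := hg.connectedShape (IsUpperRightBlock.connectedShape (hg.connectedShape hS) h)
  rwa [← Finset.image_union, hg.image_image] at this

theorem exists_liesAlongPerimeter (hS : ConnectedShape S) (hconv : OrthConvex S) :
    ∃ p : Fin 6 → Cell, LiesAlongPerimeter S p := by
  obtain ⟨⟨x, y⟩, hs, hmax⟩ := S.exists_max_image Prod.snd (connectedShape_iff.1 hS).1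
  have hdisj : Disjoint S (horizontalBlock (x, y + 1)) := by
    rw [Finset.disjoint_left]
    intro s hs hs'
    have := hmax s hs
    simp only [horizontalBlock, Finset.mem_insert, Finset.mem_singleton, Prod.ext_iff] at this hs'
    omega
  have hc : (x, y + 1) ∈ horizontalBlock (x, y + 1) := by simp [horizontalBlock]
  obtain ⟨p, hp⟩ := exists_nodes_eq (A := horizontalBlock (x, y + 1))
    (IsBlock.card_eq ⟨_, Or.inl rfl⟩)
  refine ⟨p, by rwa [hp], Or.inl ⟨_, hp, (x, y), (x, y + 1), ?_, by rwa [hp], rfl⟩⟩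
  rw [mem_perimeter hconv]
  refine ⟨hs, Finset.disjoint_right.1 hdisj hc, ?_⟩
  rw [grid_adj_iff]
  simp

lemma exists_cover_cellPerimeter (hconv : OrthConvex S) :
    ∃ C : Finset Cell, ∀ c, c ∈ C ↔ c ∈ cellPerimeter S := by
  have hfin : (cellPerimeter S).Finite := by
    refine Set.Finite.subset (S.finite_toSet.biUnion fun s _ =>
      Set.toFinite {(s.1 + 1, s.2), (s.1 - 1, s.2), (s.1, s.2 + 1), (s.1, s.2 - 1)}) ?_
    rintro c ⟨s, hs⟩
    rw [mem_perimeter hconv, grid_adj_iff] at hs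
    refine Set.mem_biUnion (x := s) hs.1 ?_
    simp only [Set.mem_insert_iff, Set.mem_singleton_iff, Prod.ext_iff]
    omega
  exact ⟨hfin.toFinset, fun c => hfin.mem_toFinset⟩

theorem exists_traversal (hS : ConnectedShape S) (hconv : OrthConvex S) {p : Fin 6 → Cell}
    (hp : LiesAlongPerimeter S p) : ∃ (T : ℕ) (q : ℕ → Fin 6 → Cell), q 0 = p ∧
      IsTraversal S T q := by
  obtain ⟨W, E, hW, hWS, hES, hWE, hreach⟩ := exists_circuit hS hconv
  have hpt := isTouchingBlock_of_liesAlongPerimeter hS hconv hp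
  have hpc := hpt.connectedShape hS
  obtain ⟨b, hWp⟩ := hreach _ hpt
  have hpcard : (nodes p).card = 6 := by rw [hWp.card_eq, hW.card_eq]
  have hpW := hWp.symm.tour hpcard hpc
  have hWc : ConnectedShape (S ∪ W) := by
    obtain ⟨T, q, -, hT, hrun, -⟩ := hpW p rfl
    exact hT ▸ hrun.connected T le_rfl
  obtain ⟨C, hC⟩ := exists_cover_cellPerimeter hconv
  obtain ⟨m, hcover⟩ := exists_tour_cover hWc C fun c hc => by
    obtain ⟨s, hsc⟩ := (hC c).1 hc
    rw [mem_perimeter hconv] at hsc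
    obtain ⟨A, hA, hcA, ht⟩ := exists_block_of_adj hS hconv hsc.1 hsc.2.1 hsc.2.2
    obtain ⟨b, hr⟩ := hreach A ht
    have hAc := ht.connectedShape hS
    exact ⟨A, -1, -1, hcA, hA.tour hAc, hr.tour hW.card_eq hWc, hr.symm.tour hA.card_eq hAc⟩
  -- The approach to `W` and the return each cost at most one turn and the coverage tour contributes
  -- at least `m`, so `3 - m` circuits leave a net turn of at least 1.
  have hloop := (tour_circuit hW.card_eq hWc hWS hES hWE).iterate hWc (3 - m).toNat
  obtain ⟨T, q, h0, hT, hrun, hturn, hcov⟩ :=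
    (((hpW.trans hcover).trans hloop).trans (hWp.tour hW.card_eq hWc)) p rfl
  refine ⟨T, q, h0, hrun, fun c hc => hcov c ?_, fun s hs i => le_trans ?_ (hturn s hs i),
    by rw [hT, h0]⟩
  · exact Or.inl (Or.inl (Or.inr ((hC c).2 hc)))
  · have := Int.self_le_toNat (3 - m)
    linarith

end RotRobot

theorem mainTheorem3 (S : Finset RotRobot.Cell) (hS : RotRobot.ConnectedShape S)
    (hconv : RotRobot.OrthConvex S) :
    (∃ p : Fin 6 → RotRobot.Cell, RotRobot.LiesAlongPerimeter S p) ∧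
    ∀ p : Fin 6 → RotRobot.Cell, RotRobot.LiesAlongPerimeter S p →
      ∃ (T : ℕ) (q : ℕ → Fin 6 → RotRobot.Cell), q 0 = p ∧ RotRobot.IsTraversal S T q :=
  ⟨RotRobot.exists_liesAlongPerimeter hS hconv,
    fun _ hp => RotRobot.exists_traversal hS hconv hp⟩
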